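/- **Setting.** There are $n\ge 1$ bidders and one item. Bidder $i$'s value lies in $[0,1]$ and is drawn independently from an arbitrary probability distribution $D_i$ on $[0,1]$; $D=D_1\times\dots\times D_n$. A dominant strategy truthful auction is a (possibly randomized) measurable single-item auction in which, whatever the other bidders report, truthful reporting is optimal for every bidder and gives nonnegative utility, and whose total revenue is never negative (so the revenue lies in $[0,1]$). $R_D(h)$ is the expected revenue of auction $h$ under $D$, and $\mathrm{OPT}=\sup_h R_D(h)$ over all dominant strategy truthful auctions. For an integer $s$ (the grid width is $1/s$), an auction in $H_{1/s}$ is given by thresholds $0=\theta^i_0\le\theta^i_1\le\dots\le\theta^i_s\le\theta^i_{s+1}=1$ for each bidder $i$. The index of bidder $i$ is the largest $j$ with $v_i\ge\theta^i_j$. The item goes to the bidder with the highest index, ties being broken in favour of the smaller bidder number, and is unsold if all indices are $0$; the winner pays the lowest bid with which he would still win. An ERM rule for $H_{1/s}$ maps each finite sample $T$ of value profiles (with multiplicities) to some $h_T\in H_{1/s}$ of maximal average revenue on $T$, measurably, with tie-breaking such that each threshold $\theta^i_j$, $1\le j\le s$, is either a value of bidder $i$ occurring in $T$ or equal to $1$.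 Its split-sample growth rate is $\hat\tau(m)=\sup_{|S|=m}\bigl|\{h_T: T\subseteq S,\ |T|=\lceil m/2\rceil\}\bigr|$. Below, $S$ is a sample of $m\ge1$ independent draws from $D$. **Claim.** 1. Every auction in $H_{1/s}$ is dominant strategy truthful, and an ERM rule as above exists for all $n$ and $s$. 2. If $s\ge 2$, every such ERM rule satisfies $\hat\tau(m)\le m^{ns}$ and $$\mathbb E_S[R_D(h_S)]\ \ge\ \sup_{h\in H_{1/s}}R_D(h)-\sqrt{\frac{2ns\log(2m)}{m}}\qquad(m\ge 1).$$ 3. If $s\ge1$, then $\sup_{h\in H_{1/s}}R_D(h)\ge \mathrm{OPT}-\frac1s$. 4. Let $\epsilon_m=\left(\frac{2n\log(2m)}{m}\right)^{1/3}$ and $s_m=\lceil 1/\epsilon_m\rceil$. Every such ERM rule for $H_{1/s_m}$ satisfies, for $m\ge 1$, $$\mathbb E_S[R_D(h_S)]\ \ge\ \mathrm{OPT}-2\left(\frac{2n\log(2m)}{m}\right)^{1/3}.$$ 5. For the learner which on $m$ samples runs such an ERM rule for $H_{1/s_m}$, let the sample complexity $m(\epsilon)$ be the least $M$ such that $\mathbb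 E_S[R_D(h_S)]\ge\mathrm{OPT}-\epsilon$ for all $m\ge M$ and all $D$. There is a universal constant $C$ such that, for all $n\ge1$ and $0<\epsilon\le\frac12$, $m(\epsilon)$ exists and $m(\epsilon)\le C\,\frac{n\log(n/\epsilon)}{\epsilon^3}$; and if moreover $\epsilon\le\frac1n$, then $m(\epsilon)\le C\,\frac{n\log(1/\epsilon)}{\epsilon^3}$. In particular $m(\epsilon)=O\!\left(\frac{n\log(1/\epsilon)}{\epsilon^3}\right)$ as $\epsilon\to0$, with a constant that does not depend on $n$. -/

import Mathlib

open MeasureTheory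

noncomputable section

namespace LevelAuctions

/-- Reported (or true) values of `n` bidders for one item, each in `[0,1]`. -/
abbrev Profile (n : ℕ) := Fin n → unitInterval

/-- A (possibly randomized) direct single-item auction: winning probabilities and
(expected) payments as functions of the reported values. -/
structure Auction (n : ℕ) where
  alloc : Profile n → Fin n → ℝ
  pay : Profile n → Fin n → ℝ

/-- Revenue of an auction on a value profile. -/
def Auction.revenue {n : ℕ} (A : Auction n) (v : Profile n) : ℝ := ∑ i, A.pay v i

/-- Dominant strategy truthful single-item auctions: feasible, incentive compatible,
individually rational, with nonnegative revenue.  Individual rationality and feasibility bound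
the revenue by `1`, so that it lies in `[0,1]`. Individual payments may be negative. -/
structure Auction.IsTruthful {n : ℕ} (A : Auction n) : Prop where
  measurable_alloc : ∀ i, Measurable fun v => A.alloc v i
  measurable_pay : ∀ i, Measurable fun v => A.pay v i
  alloc_nonneg : ∀ v i, 0 ≤ A.alloc v i
  alloc_sum_le_one : ∀ v, ∑ i, A.alloc v i ≤ 1
  truthful : ∀ (v : Profile n) (i : Fin n) (b : unitInterval),
    (v i : ℝ) * A.alloc (Function.update v i b) i - A.pay (Function.update v i b) i
      ≤ (v i : ℝ) * A.alloc v i - A.pay v i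
  individually_rational : ∀ v i, 0 ≤ (v i : ℝ) * A.alloc v i - A.pay v i
  revenue_nonneg : ∀ v, 0 ≤ A.revenue v

/-- `R_D(A)`: expected revenue when bidder `i` draws his value independently from `D i`. -/
def expectedRevenue {n : ℕ} (D : Fin n → Measure unitInterval) (A : Auction n) : ℝ :=
  ∫ v, A.revenue v ∂(Measure.pi D)

/-- `OPT`: the supremum of the expected revenue over all dominant strategy truthful auctions. -/
def OPT {n : ℕ} (D : Fin n → Measure unitInterval) : ℝ :=
  ⨆ A : {A : Auction n // A.IsTruthful}, expectedRevenue D A.1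

/-- The thresholds `θ_1 ≤ ⋯ ≤ θ_s` of every bidder; `threshold i j` is `θ_{j+1}` of bidder `i`. -/
@[ext]
structure Thresholds (n s : ℕ) where
  threshold : Fin n → Fin s → unitInterval
  mono : ∀ i, Monotone (threshold i)

namespace Thresholds

variable {n s : ℕ}

/-- All thresholds of bidder `i`, including `θ_0 = 0` and `θ_{s+1} = 1`. -/
def fullThreshold (θ : Thresholds n s) (i : Fin n) (j : ℕ) : unitInterval :=
  if j = 0 then 0 else if h : j - 1 < s then θ.threshold i ⟨j - 1, h⟩ else 1

open Classical in
/-- The index of bidder `i` with value `x`: the largest `j ∈ {0, …, s+1}` with `θ_j ≤ x`. -/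
def index (θ : Thresholds n s) (i : Fin n) (x : unitInterval) : ℕ :=
  Nat.findGreatest (fun j => θ.fullThreshold i j ≤ x) (s + 1)

/-- Bidder `i` wins if his index is positive and the highest one, ties being broken in favour of
the bidder with the smaller number.  Index `0` (below `θ_1`) stands for a negative virtual value:
such a bidder is not served. -/
def Wins (θ : Thresholds n s) (v : Profile n) (i : Fin n) : Prop :=
  0 < θ.index i (v i) ∧
    ∀ k, k ≠ i → θ.index k (v k) < θ.index i (v i) ∨
      (θ.index k (v k) = θ.index i (v i) ∧ i < k)

open Classical in
/-- The level auction with these thresholds: the winner pays the lowest bid with which he would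
still win, all others pay nothing. -/
def auction (θ : Thresholds n s) : Auction n where
  alloc v i := if θ.Wins v i then 1 else 0
  pay v i :=
    if θ.Wins v i then
      sInf {x : ℝ | ∃ b : unitInterval, (b : ℝ) = x ∧ θ.Wins (Function.update v i b) i}
    else 0

end Thresholds

/-- The supremum of the expected revenue over the level auctions with `s` free thresholds per
bidder, i.e. with grid width `1 / s`. -/
def levelOPT {n : ℕ} (s : ℕ) (D : Fin n → Measure unitInterval) : ℝ :=
  ⨆ θ : Thresholds n s, expectedRevenue D θ.auction

/-- A finite sample of value profiles (with multiplicities). -/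
abbrev Sample (n : ℕ) := Multiset (Profile n)

/-- The sample that consists of the `m` given draws. -/
def sampleOf {n m : ℕ} (z : Fin m → Profile n) : Sample n := Finset.univ.val.map z

/-- `R_T(θ)`: average revenue on the sample `T`. -/
def empiricalRevenue {n s : ℕ} (T : Sample n) (θ : Thresholds n s) : ℝ :=
  (T.map θ.auction.revenue).sum / (T.card : ℝ)

/-- `h` is an empirical revenue maximization rule for the level auctions with `s` thresholds per
bidder, whose tie-breaking selects thresholds at values of the same bidder in the sample, or
at the upper end `1`. -/
structure IsERM {n s : ℕ} (h : Sample n → Thresholds n s) : Prop where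
  maximizes : ∀ (T : Sample n) (θ : Thresholds n s),
    empiricalRevenue T θ ≤ empiricalRevenue T (h T)
  at_sample : ∀ (T : Sample n) (i : Fin n) (j : Fin s),
    (h T).threshold i j = 1 ∨ ∃ v ∈ T, (h T).threshold i j = v i
  measurable : ∀ (m : ℕ) (i : Fin n) (j : Fin s),
    Measurable fun z : Fin m → Profile n => (h (sampleOf z)).threshold i j

/-- The split-sample hypothesis space: outputs of `h` on sub-samples of size `⌈|S| / 2⌉`. -/
def splitSample {n s : ℕ} (h : Sample n → Thresholds n s) (S : Sample n) :
    Set (Thresholds n s) :=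
  {θ | ∃ T : Sample n, T ≤ S ∧ T.card = (S.card + 1) / 2 ∧ h T = θ}

/-- The split-sample growth rate. -/
def growthRate {n s : ℕ} (h : Sample n → Thresholds n s) (m : ℕ) : ℕ∞ :=
  ⨆ S : {S : Sample n // S.card = m}, (splitSample h S.1).encard

/-- `E_S[R_D(h_S)]` for a sample `S` of `m` independent draws from the product of the `D i`. -/
def expectedLearnedRevenue {n s : ℕ} (D : Fin n → Measure unitInterval)
    (h : Sample n → Thresholds n s) (m : ℕ) : ℝ :=
  ∫ z, expectedRevenue D (h (sampleOf z)).auction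
    ∂(Measure.pi fun _ : Fin m => Measure.pi D)

/-- `(2 n log (2m) / m)^{1/3}`. -/
def gridWidth (n m : ℕ) : ℝ :=
  (2 * (n : ℝ) * Real.log (2 * (m : ℝ)) / (m : ℝ)) ^ (1 / 3 : ℝ)

/-- The number of thresholds per bidder used on `m` samples: the reciprocal of the grid width,
rounded up to an integer. -/
def levels (n m : ℕ) : ℕ := ⌈1 / gridWidth n m⌉₊

/-- The `M` such that, for every number `m ≥ M` of samples and all value distributions on `[0,1]`,
running on `m` samples the rule `h s` with `s = levels n m` loses at most `ε` against `OPT`. The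
sample complexity at accuracy `ε` is the least element of this set. -/
def accurateFrom {n : ℕ} (h : ∀ s : ℕ, Sample n → Thresholds n s) (ε : ℝ) : Set ℕ :=
  {M | ∀ m, M ≤ m → ∀ D : Fin n → Measure unitInterval, (∀ i, IsProbabilityMeasure (D i)) →
    OPT D - ε ≤ expectedLearnedRevenue D (h (levels n m)) m}

end LevelAuctions

end

/-! ### Level auctions: critical levels, prices, truthfulness -/

noncomputable section

namespace LevelAuctions

namespace Thresholds

variable {n s : ℕ}

/-! The loss against `OPT` splits into an estimation error and an approximation error.

Estimation. Draw a ghost sample of the same size. Swapping the two entries of any pairs preserves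
the joint law, and every auction learned after a swap is learned from half of the same double sample
of size `2m`. Its thresholds are monotone sequences in at most `2m + 1` points per bidder, so at
most `K = (2m)^(ns)` auctions can occur. Massart's lemma bounds the mean gap between sample and
ghost revenue by `√(2 log K / m)` (`IsERM.growthRate_le`, `sum_signs_select_le`,
`IsERM.expectedRevenue_sub_le`).

Approximation. The distributions may have atoms and need not be regular, so virtual values are
replaced by a price ladder: `τ k` is the largest optimal price for one bidder when the item is worth
`k/s` to the seller. Let `q` be the demand. Testing each rung against its neighbour telescopes, and
the profit `(τ j - j/s) q(τ j)` lies between `1/s` times the sums of `q(τ k)` over `j < k ≤ s` and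
over `j ≤ k < s`. The upper bound shows that a posted price earns at most the expected `ladderValue`
of the values served; decomposing a monotone allocation into posted prices extends this to every
truthful mechanism (`integral_pay_le`). The lower bound shows that a bidder in the level auction
with thresholds `τ` pays on average at least `(index - 1)/s` when he wins
(`integral_level_mul_alloc_le`). As `ladderValue ≤ index/s` and the level auction serves a highest
index, only `1/s` is lost pointwise, hence in expectation (`OPT_sub_le_levelOPT`).

Balance. With `e = gridWidth n m` and `s = ⌈1/e⌉` the two errors are `1/s` and `√(s e³)`, together
at most `2e`; requiring `2e ≤ ε` gives the sample complexity. -/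

theorem fullThreshold_zero (θ : Thresholds n s) (i : Fin n) : θ.fullThreshold i 0 = 0 := by
  simp [fullThreshold]

theorem fullThreshold_succ (θ : Thresholds n s) (i : Fin n) (j : Fin s) :
    θ.fullThreshold i (j + 1) = θ.threshold i j := by
  simp [fullThreshold]

theorem fullThreshold_of_lt (θ : Thresholds n s) (i : Fin n) {j : ℕ} (hj : s < j) :
    θ.fullThreshold i j = 1 := by
  have h1 : j ≠ 0 := by omega
  have h2 : ¬ j - 1 < s := by omega
  simp [fullThreshold, h1, h2]

theorem fullThreshold_mono (θ : Thresholds n s) (i : Fin n) : Monotone (θ.fullThreshold i) := by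
  intro a b hab
  unfold fullThreshold
  split_ifs with h1 h2 h3 h4 h5 h6 h7
  · exact le_rfl
  · exact unitInterval.nonneg'
  · exact unitInterval.nonneg'
  · omega
  · exact θ.mono i (by simp only [Fin.mk_le_mk]; omega)
  · exact unitInterval.le_one'
  · omega
  · omega
  · exact le_rfl

theorem index_le (θ : Thresholds n s) (i : Fin n) (x : unitInterval) : θ.index i x ≤ s + 1 :=
  Nat.findGreatest_le _

theorem fullThreshold_index_le (θ : Thresholds n s) (i : Fin n) (x : unitInterval) :
    θ.fullThreshold i (θ.index i x) ≤ x := by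
  classical
  refine Nat.findGreatest_spec (P := fun j => θ.fullThreshold i j ≤ x) (Nat.zero_le (s + 1)) ?_
  rw [fullThreshold_zero]
  exact unitInterval.nonneg'

theorem le_index_iff (θ : Thresholds n s) (i : Fin n) (x : unitInterval) {j : ℕ}
    (hj : j ≤ s + 1) : j ≤ θ.index i x ↔ θ.fullThreshold i j ≤ x := by
  classical
  constructor
  · intro h
    exact (θ.fullThreshold_mono i h).trans (θ.fullThreshold_index_le i x)
  · intro h
    exact Nat.le_findGreatest hj h

/-- The lowest index with which bidder `i` wins when the others have indices `J`. -/
def winLevel (i : Fin n) (J : Fin n → ℕ) : ℕ :=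
  max 1 ((Finset.univ.erase i).sup fun k => J k + if k < i then 1 else 0)

theorem winLevel_pos (i : Fin n) (J : Fin n → ℕ) : 0 < winLevel i J :=
  lt_of_lt_of_le one_pos (le_max_left _ _)

theorem winLevel_congr {i : Fin n} {J J' : Fin n → ℕ} (h : ∀ k, k ≠ i → J k = J' k) :
    winLevel i J = winLevel i J' := by
  unfold winLevel
  congr 1
  refine Finset.sup_congr rfl fun k hk => ?_
  rw [h k (Finset.ne_of_mem_erase hk)]

/-- The indices of all bidders. -/
def indices (θ : Thresholds n s) (v : Profile n) (k : Fin n) : ℕ := θ.index k (v k)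

/-- A rival with a smaller number wins ties and must be beaten by one full index; against the others
equality suffices. The `1` in the maximum excludes index `0`. Winning thus becomes a threshold
condition on the bidder's own index, at a level set by the others alone. -/
theorem wins_iff (θ : Thresholds n s) (v : Profile n) (i : Fin n) :
    θ.Wins v i ↔ winLevel i (θ.indices v) ≤ θ.index i (v i) := by
  unfold Wins winLevel indices
  rw [max_le_iff, Finset.sup_le_iff]
  refine and_congr Nat.succ_le_iff ?_
  refine forall_congr' fun k => ?_
  simp only [Finset.mem_erase, Finset.mem_univ, and_true]
  refine imp_congr_right fun hk => ?_
  rcases lt_or_gt_of_ne hk with h | h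
  · simp only [h, if_true, h.not_gt, and_false, or_false]
    exact Nat.succ_le_iff.symm
  · simp only [h, h.not_gt, if_false, and_true, add_zero]
    exact le_iff_lt_or_eq.symm

theorem winLevel_update (θ : Thresholds n s) (v : Profile n) (i : Fin n) (b : unitInterval) :
    winLevel i (θ.indices (Function.update v i b)) = winLevel i (θ.indices v) :=
  winLevel_congr fun k hk => by simp [indices, hk]

theorem auction_alloc (θ : Thresholds n s) (v : Profile n) (i : Fin n) :
    θ.auction.alloc v i = if winLevel i (θ.indices v) ≤ θ.index i (v i) then 1 else 0 := by
  simp only [auction, wins_iff]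

/-- The winner pays the threshold of the lowest winning index. -/
theorem auction_pay (θ : Thresholds n s) (v : Profile n) (i : Fin n) :
    θ.auction.pay v i = if winLevel i (θ.indices v) ≤ θ.index i (v i) then
      (θ.fullThreshold i (winLevel i (θ.indices v)) : ℝ) else 0 := by
  simp only [auction, wins_iff]
  split_ifs with h
  · have hs := h.trans (θ.index_le i (v i))
    refine IsLeast.csInf_eq ⟨⟨_, rfl, ?_⟩, ?_⟩
    · rw [winLevel_update, Function.update_self, le_index_iff θ i _ hs]
    · rintro x ⟨b, rfl, hb⟩
      rw [winLevel_update, Function.update_self, le_index_iff θ i _ hs] at hb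
      exact hb
  · rfl

theorem auction_pay_nonneg (θ : Thresholds n s) (v : Profile n) (i : Fin n) :
    0 ≤ θ.auction.pay v i := by
  rw [auction_pay]
  split_ifs
  · exact unitInterval.nonneg _
  · exact le_rfl

theorem wins_unique (θ : Thresholds n s) (v : Profile n) {i k : Fin n} (hi : θ.Wins v i)
    (hk : θ.Wins v k) : i = k := by
  by_contra hne
  rcases hi.2 k (Ne.symm hne) with h1 | ⟨h1, h1'⟩ <;> rcases hk.2 i hne with h2 | ⟨h2, h2'⟩
  · omega
  · omega
  · omega
  · exact absurd h1' h2'.not_gt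

section Measurability

variable {α : Type*} [MeasurableSpace α]

theorem measurable_fullThreshold {Θ : α → Thresholds n s}
    (hΘ : ∀ i j, Measurable fun a => (Θ a).threshold i j) (i : Fin n) (j : ℕ) :
    Measurable fun a => (Θ a).fullThreshold i j := by
  unfold fullThreshold
  split_ifs
  · exact measurable_const
  · exact hΘ _ _
  · exact measurable_const

theorem measurable_index {Θ : α → Thresholds n s} {V : α → Profile n}
    (hΘ : ∀ i j, Measurable fun a => (Θ a).threshold i j) (hV : Measurable V) (i : Fin n) :
    Measurable fun a => (Θ a).index i (V a i) := by
  classical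
  refine measurable_findGreatest fun k _ => ?_
  exact measurableSet_le (measurable_fullThreshold hΘ i k) ((measurable_pi_apply i).comp hV)

theorem measurable_winLevel {Θ : α → Thresholds n s} {V : α → Profile n}
    (hΘ : ∀ i j, Measurable fun a => (Θ a).threshold i j) (hV : Measurable V) (i : Fin n) :
    Measurable fun a => winLevel i ((Θ a).indices (V a)) :=
  (measurable_of_countable (winLevel i)).comp
    (measurable_pi_lambda _ fun k => measurable_index hΘ hV k)

theorem measurable_alloc {Θ : α → Thresholds n s} {V : α → Profile n}
    (hΘ : ∀ i j, Measurable fun a => (Θ a).threshold i j) (hV : Measurable V) (i : Fin n) :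
    Measurable fun a => (Θ a).auction.alloc (V a) i := by
  simp only [auction_alloc]
  exact Measurable.ite (measurableSet_le (measurable_winLevel hΘ hV i) (measurable_index hΘ hV i))
    measurable_const measurable_const

theorem measurable_pay {Θ : α → Thresholds n s} {V : α → Profile n}
    (hΘ : ∀ i j, Measurable fun a => (Θ a).threshold i j) (hV : Measurable V) (i : Fin n) :
    Measurable fun a => (Θ a).auction.pay (V a) i := by
  simp only [auction_pay]
  refine Measurable.ite
    (measurableSet_le (measurable_winLevel hΘ hV i) (measurable_index hΘ hV i)) ?_ measurable_const
  -- The threshold is read off at a random level; the level is a natural number, so joint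
  -- measurability reduces to each fixed level.
  have h1 : Measurable fun q : ℕ × α => (((Θ q.2).fullThreshold i q.1 : unitInterval) : ℝ) :=
    measurable_from_prod_countable_right fun j =>
      measurable_subtype_coe.comp (measurable_fullThreshold hΘ i j)
  exact h1.comp ((measurable_winLevel hΘ hV i).prodMk measurable_id)

theorem measurable_revenue {Θ : α → Thresholds n s} {V : α → Profile n}
    (hΘ : ∀ i j, Measurable fun a => (Θ a).threshold i j) (hV : Measurable V) :
    Measurable fun a => (Θ a).auction.revenue (V a) :=
  Finset.measurable_sum _ fun i _ => measurable_pay hΘ hV i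

end Measurability

/-- Level auctions are dominant strategy truthful. -/
theorem auction_isTruthful (θ : Thresholds n s) : θ.auction.IsTruthful where
  measurable_alloc i := measurable_alloc (fun _ _ => measurable_const) measurable_id i
  measurable_pay i := measurable_pay (fun _ _ => measurable_const) measurable_id i
  alloc_nonneg v i := by
    rw [auction_alloc]
    split_ifs <;> norm_num
  alloc_sum_le_one v := by
    classical
    simp only [auction]
    rw [Finset.sum_boole]
    have : (Finset.univ.filter fun i => θ.Wins v i).card ≤ 1 :=
      Finset.card_le_one.2 fun a ha b hb =>
        θ.wins_unique v (Finset.mem_filter.1 ha).2 (Finset.mem_filter.1 hb).2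
    exact_mod_cast this
  truthful v i b := by
    -- The price is fixed by the others' reports and is at most the value exactly when truthful
    -- bidding wins.
    have key : ∀ x : unitInterval, winLevel i (θ.indices v) ≤ θ.index i x →
        θ.fullThreshold i (winLevel i (θ.indices v)) ≤ x := fun x hx =>
      (le_index_iff θ i x (hx.trans (θ.index_le i x))).1 hx
    simp only [auction_alloc, auction_pay, winLevel_update, Function.update_self]
    split_ifs with h1 h2 h2
    · exact le_rfl
    · have : v i < θ.fullThreshold i (winLevel i (θ.indices v)) := by
        rw [← not_le]
        rwa [← le_index_iff θ i _ (h1.trans (θ.index_le i b))]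
      have : (v i : ℝ) < θ.fullThreshold i (winLevel i (θ.indices v)) := this
      linarith
    · have : ((θ.fullThreshold i (winLevel i (θ.indices v)) : unitInterval) : ℝ) ≤ v i := key _ h2
      linarith
    · exact le_rfl
  individually_rational v i := by
    rw [auction_alloc, auction_pay]
    split_ifs with h
    · have : ((θ.fullThreshold i (winLevel i (θ.indices v)) : unitInterval) : ℝ) ≤ v i :=
        (le_index_iff θ i _ (h.trans (θ.index_le i _))).1 h
      linarith
    · simp
  revenue_nonneg v := Finset.sum_nonneg fun i _ => θ.auction_pay_nonneg v i

end Thresholds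

/-! ### Bounds on payments and revenue of truthful auctions -/

namespace Auction

variable {n : ℕ} {A : Auction n}

theorem IsTruthful.revenue_le_one (hA : A.IsTruthful) (v : Profile n) : A.revenue v ≤ 1 := by
  refine le_trans (Finset.sum_le_sum fun i _ => ?_) (hA.alloc_sum_le_one v)
  have h1 := hA.individually_rational v i
  have h2 := mul_le_of_le_one_left (hA.alloc_nonneg v i) (unitInterval.le_one (v i))
  linarith

theorem IsTruthful.pay_le_one (hA : A.IsTruthful) (v : Profile n) (i : Fin n) :
    A.pay v i ≤ 1 := by
  have h1 := hA.individually_rational v i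
  have h2 := mul_le_of_le_one_left (hA.alloc_nonneg v i) (unitInterval.le_one (v i))
  have h3 := Finset.single_le_sum (fun k _ => hA.alloc_nonneg v k) (Finset.mem_univ i)
  have h4 := hA.alloc_sum_le_one v
  linarith

/-- A single payment may be negative, but the revenue is not, and the other bidders pay at most
their winning probabilities, in total at most `1`. This makes individual payments integrable. -/
theorem IsTruthful.neg_one_le_pay (hA : A.IsTruthful) (v : Profile n) (i : Fin n) :
    -1 ≤ A.pay v i := by
  have h0 := hA.revenue_nonneg v
  unfold revenue at h0
  rw [← Finset.add_sum_erase _ _ (Finset.mem_univ i)] at h0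
  have h1 : ∑ k ∈ Finset.univ.erase i, A.pay v k ≤ ∑ k ∈ Finset.univ.erase i, A.alloc v k := by
    refine Finset.sum_le_sum fun k _ => ?_
    have h1 := hA.individually_rational v k
    have h2 := mul_le_of_le_one_left (hA.alloc_nonneg v k) (unitInterval.le_one (v k))
    linarith
  have h2 := hA.alloc_sum_le_one v
  rw [← Finset.add_sum_erase _ _ (Finset.mem_univ i)] at h2
  have := hA.alloc_nonneg v i
  linarith

theorem IsTruthful.measurable_revenue (hA : A.IsTruthful) : Measurable A.revenue :=
  Finset.measurable_sum _ fun i _ => hA.measurable_pay i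

end Auction

section Expectation

/-- A bounded measurable function is integrable with respect to a finite measure. -/
theorem integrable_of_abs_le {α : Type*} [MeasurableSpace α] {μ : Measure α} [IsFiniteMeasure μ]
    {f : α → ℝ} (hf : Measurable f) {c : ℝ} (h : ∀ a, |f a| ≤ c) : Integrable f μ :=
  Integrable.of_bound hf.aestronglyMeasurable c (Filter.Eventually.of_forall h)

theorem Auction.IsTruthful.expectedRevenue_nonneg {n : ℕ} {A : Auction n} (hA : A.IsTruthful)
    (D : Fin n → Measure unitInterval) : 0 ≤ expectedRevenue D A :=
  integral_nonneg hA.revenue_nonneg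

variable {n : ℕ} (D : Fin n → Measure unitInterval) [∀ i, IsProbabilityMeasure (D i)]
  {A : Auction n}

theorem Auction.IsTruthful.abs_revenue_le (hA : A.IsTruthful) (v : Profile n) :
    |A.revenue v| ≤ 1 := by
  rw [abs_of_nonneg (hA.revenue_nonneg v)]
  exact hA.revenue_le_one v

theorem Auction.IsTruthful.integrable_revenue (hA : A.IsTruthful) :
    Integrable A.revenue (Measure.pi D) :=
  integrable_of_abs_le hA.measurable_revenue hA.abs_revenue_le

theorem Auction.IsTruthful.expectedRevenue_le_one (hA : A.IsTruthful) :
    expectedRevenue D A ≤ 1 := by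
  refine (integral_mono (hA.integrable_revenue D) (integrable_const (1 : ℝ))
    hA.revenue_le_one).trans ?_
  simp

instance (n s : ℕ) : Nonempty (Thresholds n s) := ⟨⟨fun _ _ => 1, fun _ _ _ _ => le_rfl⟩⟩

instance (n : ℕ) : Nonempty {A : Auction n // A.IsTruthful} :=
  ⟨⟨_, (Classical.arbitrary (Thresholds n 0)).auction_isTruthful⟩⟩

theorem OPT_le_one : OPT D ≤ 1 := ciSup_le fun A => A.2.expectedRevenue_le_one D

theorem expectedRevenue_le_levelOPT {s : ℕ} (θ : Thresholds n s) :
    expectedRevenue D θ.auction ≤ levelOPT s D :=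
  le_ciSup (f := fun θ : Thresholds n s => expectedRevenue D θ.auction)
    ⟨1, by rintro _ ⟨θ, rfl⟩; exact θ.auction_isTruthful.expectedRevenue_le_one D⟩ θ

end Expectation

end LevelAuctions

/-! ### Order statistics and a measurable empirical revenue maximizer -/

namespace LevelAuctions

section OrderStatistics

theorem countP_le_countP {α : Type*} {W : Multiset α} {p q : α → Prop} [DecidablePred p]
    [DecidablePred q] (h : ∀ x ∈ W, p x → q x) : W.countP p ≤ W.countP q := by
  induction W using Multiset.induction with
  | empty => simp
  | cons a W ih =>
    have ha := h a (Multiset.mem_cons_self a W)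
    have ih := ih fun x hx => h x (Multiset.mem_cons_of_mem hx)
    rw [Multiset.countP_cons, Multiset.countP_cons]
    split_ifs with h1 h2 h2
    · exact Nat.add_le_add_right ih 1
    · exact absurd (ha h1) h2
    · exact ih.trans (Nat.le_succ _)
    · exact ih

/-- Take the largest element of `W` satisfying `p`. -/
theorem exists_mem_countP_le {α : Type*} [LinearOrder α] {W : Multiset α} {p : α → Prop}
    [DecidablePred p] (h : 0 < W.countP p) :
    ∃ x ∈ W, p x ∧ W.countP p ≤ W.countP (· ≤ x) := by
  obtain ⟨y, hy, hpy⟩ := Multiset.countP_pos.1 h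
  have hne : (W.filter p).toFinset.Nonempty := ⟨y, by simp [hy, hpy]⟩
  obtain ⟨x, hx, hmax⟩ := Finset.exists_max_image _ id hne
  rw [Multiset.mem_toFinset, Multiset.mem_filter] at hx
  exact ⟨x, hx.1, hx.2, countP_le_countP fun z hz hpz => hmax z (by simp [hz, hpz])⟩

/-- The element of rank `k` (starting from `0`) of a multiset in `[0,1]`, or `1` if there are at
most `k` elements. -/
def orderStat (W : Multiset unitInterval) (k : ℕ) : unitInterval :=
  sInf {t | k < W.countP (· ≤ t)}

theorem orderStat_mono (W : Multiset unitInterval) : Monotone (orderStat W) :=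
  fun _ _ hkl => sInf_le_sInf fun _ ht => lt_of_le_of_lt hkl ht

/-- Counting with strict inequality yields an attained witness below `t`, namely the largest element
below it. The count is a sum of indicators of the entries, which gives measurability of `orderStat`.
-/
theorem orderStat_lt_iff {W : Multiset unitInterval} {k : ℕ} {t : unitInterval} :
    orderStat W k < t ↔ k < W.countP (· < t) := by
  unfold orderStat
  rw [sInf_lt_iff]
  constructor
  · rintro ⟨u, hu, hut⟩
    exact lt_of_lt_of_le hu (countP_le_countP fun x _ hx => lt_of_le_of_lt hx hut)
  · intro h
    obtain ⟨x, -, hxt, hx⟩ := exists_mem_countP_le (Nat.zero_lt_of_lt h)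
    exact ⟨x, lt_of_lt_of_le h hx, hxt⟩

theorem orderStat_eq_one_or_mem (W : Multiset unitInterval) (k : ℕ) :
    orderStat W k = 1 ∨ orderStat W k ∈ W := by
  by_cases hne : (W.toFinset.filter fun x => k < W.countP (· ≤ x)).Nonempty
  · right
    obtain ⟨x, hx, hmin⟩ := Finset.exists_min_image _ id hne
    simp only [Finset.mem_filter, Multiset.mem_toFinset, id] at hx hmin
    have : orderStat W k = x := by
      refine IsLeast.csInf_eq ⟨hx.2, fun u hu => ?_⟩
      obtain ⟨y, hy, hyu, hle⟩ := exists_mem_countP_le (Nat.zero_lt_of_lt hu)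
      exact (hmin y ⟨hy, lt_of_lt_of_le hu hle⟩).trans hyu
    rw [this]
    exact hx.1
  · left
    have : {t | k < W.countP (· ≤ t)} = ∅ := by
      refine Set.eq_empty_of_forall_notMem fun u hu => hne ?_
      obtain ⟨y, hy, -, hle⟩ := exists_mem_countP_le (Nat.zero_lt_of_lt hu)
      exact ⟨y, by simpa using ⟨hy, lt_of_lt_of_le hu hle⟩⟩
    unfold orderStat
    rw [this, sInf_empty]
    rfl

/-- The smallest element of `W` not below `t` (or `1`) is at least `t`. -/
theorem le_orderStat_countP_lt (W : Multiset unitInterval) (t : unitInterval) :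
    t ≤ orderStat W (W.countP (· < t)) := by
  rw [← not_lt, orderStat_lt_iff]
  exact lt_irrefl _

/-- Rounding `t` up to the sample is invisible to sample values: if `t ≤ x`, then `x` itself adds
one to the number of elements below `t`. -/
theorem orderStat_countP_lt_le_iff {W : Multiset unitInterval} {t x : unitInterval} (hx : x ∈ W) :
    orderStat W (W.countP (· < t)) ≤ x ↔ t ≤ x := by
  refine ⟨(le_orderStat_countP_lt W t).trans, fun htx => sInf_le ?_⟩
  obtain ⟨W', rfl⟩ := Multiset.exists_cons_of_mem hx
  simp only [Set.mem_ofPred_eq]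
  rw [Multiset.countP_cons_of_neg (p := (· < t)) _ htx.not_gt,
    Multiset.countP_cons_of_pos (p := (· ≤ x)) _ le_rfl,
    Nat.lt_succ_iff]
  exact countP_le_countP fun y _ hy => hy.le.trans htx

theorem countP_univ_map {α : Type*} {m : ℕ} (f : Fin m → α) (p : α → Prop) [DecidablePred p] :
    (Finset.univ.val.map f).countP p = ∑ a, if p (f a) then 1 else 0 := by
  rw [Multiset.countP_map]
  exact Finset.card_filter (fun a => p (f a)) Finset.univ

theorem measurable_orderStat (m k : ℕ) :
    Measurable fun w : Fin m → unitInterval => orderStat (Finset.univ.val.map w) k := by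
  refine measurable_of_Iio fun t => ?_
  have : (fun w : Fin m → unitInterval => orderStat (Finset.univ.val.map w) k) ⁻¹' Set.Iio t
      = {w | k < ∑ a, if w a < t then 1 else 0} := by
    ext w
    rw [Set.mem_preimage, Set.mem_Iio, orderStat_lt_iff, countP_univ_map, Set.mem_ofPred_eq]
  rw [this]
  refine measurableSet_lt measurable_const (Finset.measurable_sum _ fun a _ => ?_)
  exact Measurable.ite (measurableSet_lt (measurable_pi_apply a) measurable_const)
    measurable_const measurable_const

end OrderStatistics

/-- A maximizer over a finite set can be selected measurably. -/
theorem exists_measurable_argmax (C : Type*) [Finite C] [Nonempty C] [MeasurableSpace C] :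
    ∃ σ : (C → ℝ) → C, Measurable σ ∧ ∀ (f : C → ℝ) (c : C), f c ≤ f (σ f) := by
  classical
  obtain ⟨g, hg⟩ := exists_surjective_nat C
  have hex : ∀ f : C → ℝ, ∃ k, ∀ c, f c ≤ f (g k) := fun f => by
    obtain ⟨c₀, hc₀⟩ := Finite.exists_max f
    obtain ⟨k, rfl⟩ := hg c₀
    exact ⟨k, hc₀⟩
  refine ⟨fun f => g (Nat.find (hex f)), ?_, fun f c => Nat.find_spec (hex f) c⟩
  -- The first maximizer in a fixed enumeration is chosen; each event that `g k` is a maximizer is a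
  -- finite intersection of measurable sets.
  refine (measurable_of_countable g).comp (measurable_find hex fun k => ?_)
  have : {f : C → ℝ | ∀ c, f c ≤ f (g k)} = ⋂ c, {f | f c ≤ f (g k)} := by
    ext f
    simp
  rw [this]
  exact MeasurableSet.iInter fun c =>
    measurableSet_le (measurable_pi_apply c) (measurable_pi_apply (g k))

variable {n s : ℕ}

theorem card_sampleOf {m : ℕ} (z : Fin m → Profile n) : (sampleOf z).card = m := by
  simp [sampleOf]

theorem empiricalRevenue_sampleOf {m : ℕ} (z : Fin m → Profile n) (θ : Thresholds n s) :
    empiricalRevenue (sampleOf z) θ = (∑ a, θ.auction.revenue (z a)) / m := by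
  unfold empiricalRevenue
  rw [card_sampleOf]
  simp only [sampleOf, Multiset.map_map, Finset.sum, Function.comp_def]

/-- Raising the thresholds raises the revenue on a profile, as long as no index changes. -/
theorem Thresholds.revenue_le_revenue {θ θ' : Thresholds n s} {v : Profile n}
    (hle : ∀ i j, θ.threshold i j ≤ θ'.threshold i j)
    (hiff : ∀ i j, θ'.threshold i j ≤ v i ↔ θ.threshold i j ≤ v i) :
    θ.auction.revenue v ≤ θ'.auction.revenue v := by
  have hfull : ∀ i j, θ.fullThreshold i j ≤ θ'.fullThreshold i j := fun i j => by
    unfold fullThreshold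
    split_ifs
    · exact le_rfl
    · exact hle _ _
    · exact le_rfl
  have hidx : ∀ i, θ'.index i (v i) = θ.index i (v i) := fun i => by
    unfold index
    congr 1
    funext j
    unfold fullThreshold
    split_ifs
    · rfl
    · exact propext (hiff _ _)
    · rfl
  have hJ : θ'.indices v = θ.indices v := funext hidx
  refine Finset.sum_le_sum fun i _ => ?_
  rw [auction_pay, auction_pay, hJ, hidx]
  split_ifs
  · exact hfull _ _
  · exact le_rfl

section EmpiricalRevenueMaximization

/-- Ranks for the thresholds of all bidders on a sample of size `m`. -/
abbrev ThresholdRanks (n s m : ℕ) :=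
  {c : Fin n → Fin s → Fin (m + 1) // ∀ i, Monotone (c i)}

instance (n s m : ℕ) : Nonempty (ThresholdRanks n s m) := ⟨⟨fun _ _ => 0, fun _ _ _ _ => le_rfl⟩⟩

/-- The thresholds at the sample values of given ranks. -/
def thresholdsOfRanks {m : ℕ} (T : Sample n) (c : ThresholdRanks n s m) : Thresholds n s where
  threshold i j := orderStat (T.map fun v => v i) (c.1 i j)
  mono i _ _ hjk := orderStat_mono _ (c.2 i hjk)

/-- Rounding every threshold up to the next sample value changes no index on the sample and can only
raise prices. Hence finitely many rank vectors suffice; the rank `T.card` stands for the threshold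
`1`. -/
theorem exists_ranks_empiricalRevenue_le (T : Sample n) (θ : Thresholds n s) :
    ∃ c : ThresholdRanks n s T.card,
      empiricalRevenue T θ ≤ empiricalRevenue T (thresholdsOfRanks T c) := by
  refine ⟨⟨fun i j => ⟨(T.map fun v => v i).countP (· < θ.threshold i j), ?_⟩, ?_⟩, ?_⟩
  · exact Nat.lt_succ_of_le ((Multiset.countP_le_card _ _).trans (Multiset.card_map _ _).le)
  · intro i j k hjk
    exact countP_le_countP fun x _ hx => lt_of_lt_of_le hx (θ.mono i hjk)
  · refine div_le_div_of_nonneg_right ?_ (Nat.cast_nonneg _)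
    refine Multiset.sum_map_le_sum_map _ _ fun v hv => Thresholds.revenue_le_revenue ?_ ?_
    · exact fun i j => le_orderStat_countP_lt _ _
    · exact fun i j => orderStat_countP_lt_le_iff (Multiset.mem_map_of_mem (fun v => v i) hv)

theorem measurable_threshold_thresholdsOfRanks {m : ℕ} (c : ThresholdRanks n s m) (i : Fin n)
    (j : Fin s) : Measurable fun z : Fin m → Profile n =>
      (thresholdsOfRanks (sampleOf z) c).threshold i j := by
  have h : Measurable fun (z : Fin m → Profile n) (a : Fin m) => z a i :=
    measurable_pi_lambda _ fun a => (measurable_pi_apply i).comp (measurable_pi_apply a)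
  have := (measurable_orderStat m (c.1 i j)).comp h
  simpa only [thresholdsOfRanks, sampleOf, Multiset.map_map, Function.comp_def] using this

/-- An empirical revenue maximization rule with thresholds at sample values exists. -/
theorem exists_isERM (n s : ℕ) : ∃ h : Sample n → Thresholds n s, IsERM h := by
  -- The discrete σ-algebra on the finite set of ranks lets thresholds at measurably selected ranks
  -- be treated rank by rank.
  let _ (m : ℕ) : MeasurableSpace (ThresholdRanks n s m) := ⊤
  choose σ hσ hmax using fun m => exists_measurable_argmax (ThresholdRanks n s m)
  let r (m : ℕ) (T : Sample n) : ThresholdRanks n s m :=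
    σ m fun c => empiricalRevenue T (thresholdsOfRanks T c)
  refine ⟨fun T => thresholdsOfRanks T (r T.card T), ⟨fun T θ => ?_, fun T i j => ?_, ?_⟩⟩
  · obtain ⟨c, hc⟩ := exists_ranks_empiricalRevenue_le T θ
    exact hc.trans (hmax T.card (fun c => empiricalRevenue T (thresholdsOfRanks T c)) c)
  · refine (orderStat_eq_one_or_mem (T.map fun v : Profile n => v i)
      ((r T.card T).1 i j)).imp id fun h => ?_
    obtain ⟨v, hv, hvi⟩ := Multiset.mem_map.1 h
    exact ⟨v, hv, hvi.symm⟩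
  · intro m i j
    have hr : Measurable fun z : Fin m → Profile n => r m (sampleOf z) := by
      refine (hσ m).comp (measurable_pi_lambda _ fun c => ?_)
      simp only [empiricalRevenue_sampleOf]
      exact (Finset.measurable_sum _ fun a _ => Thresholds.measurable_revenue
        (measurable_threshold_thresholdsOfRanks c) (measurable_pi_apply a)).div_const _
    have hq : Measurable fun q : ThresholdRanks n s m × (Fin m → Profile n) =>
        (thresholdsOfRanks (sampleOf q.2) q.1).threshold i j :=
      measurable_from_prod_countable_right fun c => measurable_threshold_thresholdsOfRanks c i j
    -- The type of the ranks depends on the sample size, which is constantly `m` here.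
    have heq : (fun z : Fin m → Profile n =>
        (thresholdsOfRanks (sampleOf z) (r (sampleOf z).card (sampleOf z))).threshold i j)
        = fun z => (thresholdsOfRanks (sampleOf z) (r m (sampleOf z))).threshold i j := by
      funext z
      rw [card_sampleOf]
    rw [heq]
    exact hq.comp (hr.prodMk measurable_id)

end EmpiricalRevenueMaximization

end LevelAuctions

/-! ### Counting learned auctions: the split-sample growth rate -/

namespace LevelAuctions

/-- Raising `s` by one multiplies the binomial by `(m + s + 1)/(s + 1) ≤ m`. The base case `(m +
2)(m + 1)/2 ≤ m²` needs `m ≥ 4`, and `s = 1` fails since `m + 1 > m`. -/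
theorem choose_add_le_pow {m s : ℕ} (hm : 4 ≤ m) (hs : 2 ≤ s) : (m + s).choose s ≤ m ^ s := by
  induction s, hs using Nat.le_induction with
  | base =>
    rw [Nat.choose_two_right]
    refine Nat.div_le_of_le_mul ?_
    simp only [Nat.add_succ_sub_one]
    nlinarith
  | succ s hs ih =>
    have h := Nat.add_one_mul_choose_eq (m + s) s
    have h1 : (m + s + 1) ≤ m * (s + 1) := by nlinarith
    refine Nat.le_of_mul_le_mul_right (c := s + 1) ?_ (Nat.succ_pos s)
    calc (m + (s + 1)).choose (s + 1) * (s + 1) = (m + s + 1) * (m + s).choose s := h.symm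
      _ ≤ (m * (s + 1)) * m ^ s := Nat.mul_le_mul h1 ih
      _ = m ^ (s + 1) * (s + 1) := by ring

/-- The number of monotone sequences of length `s` in a finite set. -/
theorem encard_monotone_le {α : Type*} [LinearOrder α] (W : Finset α) (s : ℕ) :
    {f : Fin s → α | Monotone f ∧ ∀ j, f j ∈ W}.encard ≤ ((W.card + s - 1).choose s : ℕ) := by
  classical
  -- A monotone sequence is the sorted list of its multiset of values, hence is determined by it.
  let g : {f : Fin s → α | Monotone f ∧ ∀ j, f j ∈ W} → Sym W s := fun f =>
    ⟨Finset.univ.val.map fun j => ⟨f.1 j, f.2.2 j⟩, by simp⟩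
  have hg : Function.Injective g := by
    intro f f' h
    have h1 : (Finset.univ.val.map fun j => (⟨f.1 j, f.2.2 j⟩ : W))
        = Finset.univ.val.map fun j => (⟨f'.1 j, f'.2.2 j⟩ : W) := congrArg Subtype.val h
    have h2 := congrArg (Multiset.map Subtype.val) h1
    rw [Multiset.map_map, Multiset.map_map, Fin.univ_val_map, Fin.univ_val_map,
      Multiset.coe_eq_coe] at h2
    have h3 := h2.eq_of_pairwise (fun a b _ _ => le_antisymm)
      (List.sortedLE_ofFn_iff.2 f.2.1).pairwise (List.sortedLE_ofFn_iff.2 f'.2.1).pairwise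
    exact Subtype.ext (List.ofFn_injective h3)
  have := ENat.card_le_card_of_injective hg
  rw [ENat.card_eq_coe_fintype_card (α := Sym W s), Sym.card_sym_eq_choose, Fintype.card_coe] at this
  exact this

variable {n s : ℕ}

/-- The number of threshold vectors with the thresholds of bidder `i` in a finite set `W i`. -/
theorem encard_thresholds_le (W : Fin n → Finset unitInterval) (N : ℕ)
    (hN : ∀ i, ((W i).card + s - 1).choose s ≤ N) :
    {θ : Thresholds n s | ∀ i j, θ.threshold i j ∈ W i}.encard ≤ ((N ^ n : ℕ) : ℕ∞) := by
  classical
  have hM : ∀ i, ∃ F : Finset (Fin s → unitInterval), F.card ≤ N ∧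
      ∀ f, Monotone f → (∀ j, f j ∈ W i) → f ∈ F := fun i => by
    have h := (encard_monotone_le (W i) s).trans (Nat.cast_le.2 (hN i))
    have hfin := Set.finite_of_encard_le_coe h
    refine ⟨hfin.toFinset, ?_, fun f h1 h2 => by simpa using ⟨h1, h2⟩⟩
    rw [hfin.encard_eq_coe_toFinset_card] at h
    exact_mod_cast h
  choose F hFcard hF using hM
  have hinj : Function.Injective (Thresholds.threshold : Thresholds n s → _) :=
    fun θ θ' h => Thresholds.ext h
  rw [← hinj.encard_image]
  calc _ ≤ ((Fintype.piFinset F : Finset _) : Set (Fin n → Fin s → unitInterval)).encard := by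
        refine Set.encard_le_encard ?_
        rintro _ ⟨θ, hθ, rfl⟩
        exact Finset.mem_coe.2 (Fintype.mem_piFinset.2 fun i => hF i _ (θ.mono i) (hθ i))
    _ ≤ ((N ^ n : ℕ) : ℕ∞) := by
        rw [Set.encard_coe_eq_coe_finsetCard, Fintype.card_piFinset]
        refine Nat.cast_le.2 ((Finset.prod_le_prod' fun i _ => hFcard i).trans ?_)
        simp

theorem encard_splitSample_le_choose (h : Sample n → Thresholds n s) (S : Sample n) :
    (splitSample h S).encard ≤ (S.card.choose ((S.card + 1) / 2) : ℕ) := by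
  classical
  calc (splitSample h S).encard
      ≤ (h '' ((S.powersetCard ((S.card + 1) / 2)).toFinset : Set (Sample n))).encard := by
        refine Set.encard_le_encard ?_
        rintro θ ⟨T, hT, hc, rfl⟩
        exact ⟨T, by simp [Multiset.mem_powersetCard, hT, hc], rfl⟩
    _ ≤ _ := Set.encard_image_le _ _
    _ ≤ _ := by
        rw [Set.encard_coe_eq_coe_finsetCard, ← Multiset.card_powersetCard]
        exact Nat.cast_le.2 (Multiset.toFinset_card_le _)

/-- All thresholds of a bidder lie among his values in `S` and `1`, at most `S.card + 1` points, so
each bidder has at most `(S.card + s).choose s` threshold sequences. -/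
theorem IsERM.encard_splitSample_le {h : Sample n → Thresholds n s} (hh : IsERM h) (hn : 1 ≤ n)
    (hs : 2 ≤ s) (S : Sample n) (hS : 1 ≤ S.card) :
    (splitSample h S).encard ≤ ((S.card ^ (n * s) : ℕ) : ℕ∞) := by
  classical
  rcases lt_or_ge S.card 4 with h4 | h4
  · refine (encard_splitSample_le_choose h S).trans (Nat.cast_le.2 ?_)
    -- Below four the binomial bound can fail (`10 > 9` for three profiles and `s = 2`), but there
    -- are at most `S.card` subsamples of the required size.
    have h1 : S.card.choose ((S.card + 1) / 2) ≤ S.card := by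
      interval_cases S.card <;> decide
    exact h1.trans (Nat.le_self_pow (by positivity) _)
  · let W : Fin n → Finset unitInterval := fun i => insert 1 (S.map fun v => v i).toFinset
    have hW : ∀ i, (W i).card ≤ S.card + 1 := fun i => by
      refine (Finset.card_insert_le _ _).trans (Nat.add_le_add_right ?_ 1)
      exact (Multiset.toFinset_card_le _).trans (Multiset.card_map _ _).le
    have key := encard_thresholds_le (s := s) W (S.card ^ s) fun i =>
      (Nat.choose_le_choose s (by have := hW i; omega)).trans (choose_add_le_pow h4 hs)
    rw [← pow_mul, mul_comm s n] at key
    refine le_trans (Set.encard_le_encard ?_) key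
    rintro θ ⟨T, hT, -, rfl⟩ i j
    rcases hh.at_sample T i j with h1 | ⟨v, hv, h1⟩
    · rw [h1]
      exact Finset.mem_insert_self _ _
    · rw [h1]
      exact Finset.mem_insert_of_mem (Multiset.mem_toFinset.2
        (Multiset.mem_map_of_mem (fun v => v i) (Multiset.mem_of_le hT hv)))

theorem IsERM.growthRate_le {h : Sample n → Thresholds n s} (hh : IsERM h) (hn : 1 ≤ n)
    (hs : 2 ≤ s) {m : ℕ} (hm : 1 ≤ m) : growthRate h m ≤ ((m ^ (n * s) : ℕ) : ℕ∞) := by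
  refine iSup_le ?_
  rintro ⟨S, rfl⟩
  exact hh.encard_splitSample_le hn hs S hm

end LevelAuctions

/-! ### Massart's lemma, symmetrization, generalization bound -/

namespace LevelAuctions

/-- `-1` for `true`, `1` for `false`. -/
def signOf (b : Bool) : ℝ := if b then -1 else 1

/-- The exponential moment of a sum of independent signs factorizes over coordinates, and each
factor obeys `cosh x ≤ exp (x²/2)`. -/
theorem sum_exp_signs_le {m : ℕ} {a : Fin m → ℝ} (ha : ∀ i, |a i| ≤ 1) (l : ℝ) :
    ∑ σ : Fin m → Bool, Real.exp (l * ∑ i, signOf (σ i) * a i)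
      ≤ 2 ^ m * Real.exp (m * (l ^ 2 / 2)) := by
  have h1 : ∀ σ : Fin m → Bool, Real.exp (l * ∑ i, signOf (σ i) * a i)
      = ∏ i, Real.exp (l * (signOf (σ i) * a i)) := fun σ => by
    rw [Finset.mul_sum, Real.exp_sum]
  simp only [h1]
  rw [← Fintype.piFinset_univ, ← Finset.prod_univ_sum (fun _ : Fin m => (Finset.univ : Finset Bool))
    fun i b => Real.exp (l * (signOf b * a i))]
  have h2 : ∀ i, ∑ b : Bool, Real.exp (l * (signOf b * a i)) ≤ 2 * Real.exp (l ^ 2 / 2) := by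
    intro i
    have h3 : ∑ b : Bool, Real.exp (l * (signOf b * a i)) = 2 * Real.cosh (l * a i) := by
      rw [Fintype.sum_bool, Real.cosh_eq]
      simp only [signOf, if_true, Bool.false_eq_true, if_false]
      ring_nf
    rw [h3]
    have h4 : (l * a i) ^ 2 ≤ l ^ 2 := by
      rw [mul_pow]
      have := (sq_le_one_iff_abs_le_one (a i)).2 (ha i)
      nlinarith [sq_nonneg l]
    have h5 := Real.cosh_le_exp_half_sq (l * a i)
    have h6 : Real.exp ((l * a i) ^ 2 / 2) ≤ Real.exp (l ^ 2 / 2) :=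
      Real.exp_le_exp.2 (by linarith)
    linarith
  refine (Finset.prod_le_prod (fun i _ => Finset.sum_nonneg fun b _ => (Real.exp_pos _).le)
    fun i _ => h2 i).trans ?_
  rw [Finset.prod_const, Finset.card_univ, Fintype.card_fin, mul_pow, ← Real.exp_nat_mul]

/-- Massart's finite class lemma, for a selection of a vector for each choice of signs. -/
theorem sum_signs_select_le {m : ℕ} (hm : 0 < m) {H : Type*} (F : Finset H) {a : H → Fin m → ℝ}
    (ha : ∀ h i, |a h i| ≤ 1) {K : ℝ} (hK : 1 < K) (hF : (F.card : ℝ) ≤ K)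
    (c : (Fin m → Bool) → H) (hc : ∀ σ, c σ ∈ F) :
    ∑ σ : Fin m → Bool, ∑ i, signOf (σ i) * a (c σ) i
      ≤ 2 ^ m * Real.sqrt (2 * m * Real.log K) := by
  have hm' : (0 : ℝ) < m := Nat.cast_pos.2 hm
  have hlog : 0 < Real.log K := Real.log_pos hK
  have hK0 : 0 < K := by linarith
  -- This `l` makes `m l²/2 = log K`, so each vector has mean exponential moment at most `K`, and
  -- the at most `K` vectors together at most `K²`.
  set l := Real.sqrt (2 * Real.log K / m) with hl
  have hl0 : 0 < l := Real.sqrt_pos.2 (by positivity)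
  have hl2 : m * (l ^ 2 / 2) = Real.log K := by
    rw [hl, Real.sq_sqrt (by positivity)]
    field_simp
  have hlmul : l * Real.sqrt (2 * m * Real.log K) = 2 * Real.log K := by
    rw [hl, ← Real.sqrt_mul (by positivity),
      show 2 * Real.log K / m * (2 * m * Real.log K) = (2 * Real.log K) ^ 2 by
        field_simp,
      Real.sqrt_sq (by positivity)]
  have hexp : ∑ σ : Fin m → Bool, Real.exp (l * ∑ i, signOf (σ i) * a (c σ) i)
      ≤ 2 ^ m * K ^ 2 := by
    calc ∑ σ : Fin m → Bool, Real.exp (l * ∑ i, signOf (σ i) * a (c σ) i)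
        ≤ ∑ σ : Fin m → Bool, ∑ h ∈ F, Real.exp (l * ∑ i, signOf (σ i) * a h i) :=
          Finset.sum_le_sum fun σ _ => Finset.single_le_sum
            (f := fun h => Real.exp (l * ∑ i, signOf (σ i) * a h i))
            (fun h _ => (Real.exp_pos _).le) (hc σ)
      _ = ∑ h ∈ F, ∑ σ : Fin m → Bool, Real.exp (l * ∑ i, signOf (σ i) * a h i) :=
          Finset.sum_comm
      _ ≤ ∑ h ∈ F, 2 ^ m * K := Finset.sum_le_sum fun h _ => by
          have := sum_exp_signs_le (ha h) l
          rwa [hl2, Real.exp_log hK0] at this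
      _ = F.card * (2 ^ m * K) := by rw [Finset.sum_const, nsmul_eq_mul]
      _ ≤ K * (2 ^ m * K) := by gcongr
      _ = 2 ^ m * K ^ 2 := by ring
  -- The tangent to `exp` at `2 log K` takes the place of Jensen's inequality.
  have hlin : ∀ x : ℝ, l * x ≤ Real.exp (l * x) / K ^ 2 - 1 + 2 * Real.log K := fun x => by
    have h := Real.add_one_le_exp (l * x - 2 * Real.log K)
    rw [Real.exp_sub, show Real.exp (2 * Real.log K) = K ^ 2 by
      rw [two_mul, Real.exp_add, Real.exp_log hK0, sq]] at h
    linarith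
  refine le_of_mul_le_mul_left ?_ hl0
  calc l * ∑ σ : Fin m → Bool, ∑ i, signOf (σ i) * a (c σ) i
      = ∑ σ : Fin m → Bool, l * ∑ i, signOf (σ i) * a (c σ) i := Finset.mul_sum _ _ _
    _ ≤ ∑ σ : Fin m → Bool, (Real.exp (l * ∑ i, signOf (σ i) * a (c σ) i) / K ^ 2 - 1
          + 2 * Real.log K) := Finset.sum_le_sum fun σ _ => hlin _
    _ = (∑ σ : Fin m → Bool, Real.exp (l * ∑ i, signOf (σ i) * a (c σ) i)) / K ^ 2
          + 2 ^ m * (2 * Real.log K - 1) := by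
        rw [Finset.sum_add_distrib, Finset.sum_sub_distrib, Finset.sum_div]
        simp
        ring
    _ ≤ 2 ^ m + 2 ^ m * (2 * Real.log K - 1) := by
        gcongr
        exact (div_le_iff₀ (by positivity)).2 hexp
    _ = l * (2 ^ m * Real.sqrt (2 * m * Real.log K)) := by
        rw [mul_left_comm, hlmul]
        ring

theorem integral_comp_measurePreserving {α β : Type*} [MeasurableSpace α] [MeasurableSpace β]
    {μ : Measure α} {ν : Measure β} {T : α → β} (hT : MeasurePreserving T μ ν) {f : β → ℝ}
    (hf : Measurable f) : ∫ x, f (T x) ∂μ = ∫ y, f y ∂ν := by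
  rw [← hT.map_eq, integral_map hT.measurable.aemeasurable hf.aestronglyMeasurable]

section GhostSample

variable {n s m : ℕ}

theorem sampleOf_eq_sum (z : Fin m → Profile n) : sampleOf z = ∑ a, {z a} := by
  unfold sampleOf
  rw [Finset.sum, ← Multiset.sum_map_singleton (Finset.univ.val.map z), Multiset.map_map]
  rfl

/-- Exchange the two entries of the pairs selected by `σ`. -/
def swapAt {X : Type*} (σ : Fin m → Bool) (w : Fin m → X × X) (a : Fin m) : X × X :=
  if σ a then (w a).swap else w a

theorem measurePreserving_swapAt {X : Type*} [MeasurableSpace X] (P : Measure X)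
    [IsProbabilityMeasure P] (σ : Fin m → Bool) :
    MeasurePreserving (swapAt (X := X) σ) (Measure.pi fun _ => P.prod P)
      (Measure.pi fun _ => P.prod P) := by
  refine measurePreserving_pi (fun _ : Fin m => P.prod P) (fun _ => P.prod P)
    (f := fun a q => if σ a then q.swap else q) fun a => ?_
  cases σ a
  · simpa using! MeasurePreserving.id _
  · simpa using Measure.measurePreserving_swap

/-- A swap only redistributes the double sample between its halves, and the rule sees samples as
multisets; a half has `m = ⌈2m/2⌉` elements. -/
theorem sampleOf_fst_swapAt_mem (h : Sample n → Thresholds n s) (σ : Fin m → Bool)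
    (w : Fin m → Profile n × Profile n) :
    h (sampleOf fun a => (swapAt σ w a).1) ∈
      splitSample h (sampleOf (fun a => (w a).1) + sampleOf fun a => (w a).2) := by
  refine ⟨_, ?_, ?_, rfl⟩
  · have : sampleOf (fun a => (w a).1) + sampleOf (fun a => (w a).2)
        = sampleOf (fun a => (swapAt σ w a).1) + sampleOf fun a => (swapAt σ w a).2 := by
      simp only [sampleOf_eq_sum, ← Finset.sum_add_distrib]
      refine Finset.sum_congr rfl fun a _ => ?_
      unfold swapAt
      split_ifs
      · exact add_comm _ _
      · rfl
    rw [this]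
    exact Multiset.le_add_right _ _
  · rw [Multiset.card_add, card_sampleOf, card_sampleOf, card_sampleOf]
    omega

/-- The gap between the revenue of the learned auction on the sample and on a ghost sample. -/
def ghostGap (h : Sample n → Thresholds n s) (w : Fin m → Profile n × Profile n) : ℝ :=
  ∑ a, ((h (sampleOf fun a => (w a).1)).auction.revenue (w a).1
    - (h (sampleOf fun a => (w a).1)).auction.revenue (w a).2)

/-- A swap flips the sign of its term, but the learned auction also moves with `σ`. This is why
Massart's lemma is needed for a selection `c σ` and not for one fixed vector. -/
theorem ghostGap_swapAt (h : Sample n → Thresholds n s) (σ : Fin m → Bool)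
    (w : Fin m → Profile n × Profile n) :
    ghostGap h (swapAt σ w) = ∑ a, signOf (σ a) *
      ((h (sampleOf fun a => (swapAt σ w a).1)).auction.revenue (w a).1
        - (h (sampleOf fun a => (swapAt σ w a).1)).auction.revenue (w a).2) := by
  refine Finset.sum_congr rfl fun a _ => ?_
  generalize h (sampleOf fun a => (swapAt σ w a).1) = θ
  unfold swapAt signOf
  split_ifs
  · simp
  · simp

theorem Thresholds.abs_revenue_sub_le (θ : Thresholds n s) (v v' : Profile n) :
    |θ.auction.revenue v - θ.auction.revenue v'| ≤ 1 := by
  have h1 := θ.auction_isTruthful.revenue_nonneg v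
  have h2 := θ.auction_isTruthful.revenue_nonneg v'
  have h3 := θ.auction_isTruthful.revenue_le_one v
  have h4 := θ.auction_isTruthful.revenue_le_one v'
  rw [abs_le]
  constructor <;> linarith

theorem sum_ghostGap_swapAt_le {h : Sample n → Thresholds n s} (hm : 0 < m) {K : ℕ} (hK : 1 < K)
    (hgrowth : growthRate h (2 * m) ≤ (K : ℕ∞)) (w : Fin m → Profile n × Profile n) :
    ∑ σ : Fin m → Bool, ghostGap h (swapAt σ w) ≤ 2 ^ m * Real.sqrt (2 * m * Real.log K) := by
  let S := sampleOf (fun a => (w a).1) + sampleOf fun a => (w a).2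
  have hS : S.card = 2 * m := by
    rw [Multiset.card_add, card_sampleOf, card_sampleOf]
    omega
  have hle : (splitSample h S).encard ≤ (K : ℕ∞) :=
    (le_iSup (fun S : {S : Sample n // S.card = 2 * m} => (splitSample h S.1).encard)
      ⟨S, hS⟩).trans hgrowth
  have hfin := Set.finite_of_encard_le_coe hle
  rw [hfin.encard_eq_coe_toFinset_card] at hle
  simp only [ghostGap_swapAt]
  exact sum_signs_select_le hm hfin.toFinset
    (a := fun θ a => θ.auction.revenue (w a).1 - θ.auction.revenue (w a).2)
    (fun θ a => θ.abs_revenue_sub_le _ _) (by exact_mod_cast hK)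
    (by exact_mod_cast hle) _
    fun σ => hfin.mem_toFinset.2 (sampleOf_fst_swapAt_mem h σ w)

variable {h : Sample n → Thresholds n s}

theorem IsERM.measurable_revenue_comp (hh : IsERM h) {α : Type*} [MeasurableSpace α]
    {Z : α → Fin m → Profile n} {V : α → Profile n} (hZ : Measurable Z) (hV : Measurable V) :
    Measurable fun x => (h (sampleOf (Z x))).auction.revenue (V x) :=
  Thresholds.measurable_revenue (fun i j => (hh.measurable m i j).comp hZ) hV

theorem measurable_map_fst {X Y : Type*} [MeasurableSpace X] [MeasurableSpace Y] :
    Measurable fun (w : Fin m → X × Y) a => (w a).1 :=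
  measurable_pi_lambda _ fun a => measurable_fst.comp (measurable_pi_apply a)

theorem IsERM.measurable_ghostGap (hh : IsERM h) : Measurable (ghostGap (m := m) h) :=
  Finset.measurable_sum _ fun a _ =>
    (hh.measurable_revenue_comp measurable_map_fst (measurable_fst.comp (measurable_pi_apply a))).sub
      (hh.measurable_revenue_comp measurable_map_fst (measurable_snd.comp (measurable_pi_apply a)))

theorem abs_ghostGap_le (h : Sample n → Thresholds n s) (w : Fin m → Profile n × Profile n) :
    |ghostGap h w| ≤ m := by
  refine (Finset.abs_sum_le_sum_abs _ _).trans ?_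
  refine (Finset.sum_le_sum fun a _ => Thresholds.abs_revenue_sub_le _ _ _).trans ?_
  simp

/-- Symmetrization: the expected gap is bounded in terms of the growth rate. -/
theorem IsERM.integral_ghostGap_le (hh : IsERM h) (hm : 0 < m) {K : ℕ} (hK : 1 < K)
    (hgrowth : growthRate h (2 * m) ≤ (K : ℕ∞)) (P : Measure (Profile n))
    [IsProbabilityMeasure P] :
    ∫ w, ghostGap h w ∂(Measure.pi fun _ : Fin m => P.prod P)
      ≤ Real.sqrt (2 * m * Real.log K) := by
  set Q := Measure.pi fun _ : Fin m => P.prod P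
  -- Each swap preserves the law of the pairs, so the expected gap equals its average over all `σ`,
  -- which is bounded for every fixed `w`.
  have hswap : ∀ σ : Fin m → Bool, ∫ w, ghostGap h (swapAt σ w) ∂Q = ∫ w, ghostGap h w ∂Q := by
    exact fun σ => integral_comp_measurePreserving (measurePreserving_swapAt P σ)
      hh.measurable_ghostGap
  have hint : ∀ σ : Fin m → Bool, Integrable (fun w => ghostGap h (swapAt σ w)) Q := fun σ =>
    integrable_of_abs_le (hh.measurable_ghostGap.comp (measurePreserving_swapAt P σ).measurable)
      fun w => abs_ghostGap_le h _
  have hsum : ∫ w, ∑ σ : Fin m → Bool, ghostGap h (swapAt σ w) ∂Q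
      = 2 ^ m * ∫ w, ghostGap h w ∂Q := by
    rw [integral_finsetSum _ fun σ _ => hint σ]
    simp [hswap]
  have hle : ∫ w, ∑ σ : Fin m → Bool, ghostGap h (swapAt σ w) ∂Q
      ≤ 2 ^ m * Real.sqrt (2 * m * Real.log K) := by
    refine (integral_mono (integrable_finsetSum _ fun σ _ => hint σ) (integrable_const _)
      (sum_ghostGap_swapAt_le hm hK hgrowth)).trans ?_
    simp
  rw [hsum] at hle
  exact le_of_mul_le_mul_left hle (by positivity)

/-- The learned auction depends on the first entries only, which are independent of the ghost draws;
Fubini applies. -/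
theorem IsERM.integral_revenue_ghost (hh : IsERM h) (D : Fin n → Measure unitInterval)
    [∀ i, IsProbabilityMeasure (D i)] (a : Fin m) :
    ∫ w : Fin m → Profile n × Profile n,
        (h (sampleOf fun a => (w a).1)).auction.revenue (w a).2
        ∂(Measure.pi fun _ => (Measure.pi D).prod (Measure.pi D))
      = expectedLearnedRevenue D h m := by
  have hmeas : Measurable fun q : (Fin m → Profile n) × (Fin m → Profile n) =>
      (h (sampleOf q.1)).auction.revenue (q.2 a) :=
    hh.measurable_revenue_comp measurable_fst ((measurable_pi_apply a).comp measurable_snd)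
  have hmp := measurePreserving_arrowProdEquivProdArrow (Profile n) (Profile n) (Fin m)
    (fun _ => Measure.pi D) (fun _ => Measure.pi D)
  refine (integral_comp_measurePreserving hmp hmeas).trans ?_
  rw [integral_prod _ (integrable_of_abs_le hmeas fun q =>
    (h (sampleOf q.1)).auction_isTruthful.abs_revenue_le _)]
  refine integral_congr_ae (Filter.Eventually.of_forall fun z => ?_)
  exact integral_comp_measurePreserving (measurePreserving_eval (fun _ : Fin m => Measure.pi D) a)
    (h (sampleOf z)).auction_isTruthful.measurable_revenue

/-- The generalization bound of empirical revenue maximization in terms of the growth rate. -/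
theorem IsERM.expectedRevenue_sub_le (hh : IsERM h) (hm : 0 < m) {K : ℕ} (hK : 1 < K)
    (hgrowth : growthRate h (2 * m) ≤ (K : ℕ∞)) (D : Fin n → Measure unitInterval)
    [∀ i, IsProbabilityMeasure (D i)] (θ : Thresholds n s) :
    expectedRevenue D θ.auction - Real.sqrt (2 * Real.log K / m)
      ≤ expectedLearnedRevenue D h m := by
  set Q := Measure.pi fun _ : Fin m => (Measure.pi D).prod (Measure.pi D)
  have hm' : (0 : ℝ) < m := Nat.cast_pos.2 hm
  have hfst : ∀ a : Fin m, ∫ w, θ.auction.revenue (w a).1 ∂Q = expectedRevenue D θ.auction := by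
    intro a
    have hmp : MeasurePreserving (fun w : Fin m → Profile n × Profile n => (w a).1) Q
        (Measure.pi D) :=
      measurePreserving_fst.comp (measurePreserving_eval _ a)
    exact integral_comp_measurePreserving hmp θ.auction_isTruthful.measurable_revenue
  have hint1 : ∀ a : Fin m, Integrable (fun w : Fin m → Profile n × Profile n =>
      θ.auction.revenue (w a).1) Q := fun a =>
    integrable_of_abs_le (θ.auction_isTruthful.measurable_revenue.comp
      (measurable_fst.comp (measurable_pi_apply a))) fun w => θ.auction_isTruthful.abs_revenue_le _
  have hint2 : ∀ a : Fin m, Integrable (fun w : Fin m → Profile n × Profile n =>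
      (h (sampleOf fun a => (w a).1)).auction.revenue (w a).2) Q := fun a =>
    integrable_of_abs_le (hh.measurable_revenue_comp measurable_map_fst
      (measurable_snd.comp (measurable_pi_apply a)))
      fun w => (h (sampleOf fun a => (w a).1)).auction_isTruthful.abs_revenue_le _
  -- On the sample itself the learned auction earns at least as much as `θ`.
  have hpoint : ∀ w : Fin m → Profile n × Profile n,
      ∑ a, (θ.auction.revenue (w a).1
        - (h (sampleOf fun a => (w a).1)).auction.revenue (w a).2) ≤ ghostGap h w := by
    intro w
    have h1 := hh.maximizes (sampleOf fun a => (w a).1) θ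
    rw [empiricalRevenue_sampleOf, empiricalRevenue_sampleOf, div_le_div_iff_of_pos_right hm'] at h1
    unfold ghostGap
    rw [Finset.sum_sub_distrib, Finset.sum_sub_distrib]
    linarith
  have hkey : m * (expectedRevenue D θ.auction - expectedLearnedRevenue D h m)
      ≤ Real.sqrt (2 * m * Real.log K) := by
    refine le_trans ?_ (hh.integral_ghostGap_le hm hK hgrowth (Measure.pi D))
    refine le_trans (le_of_eq ?_) (integral_mono
      (integrable_finsetSum _ fun a _ => (hint1 a).sub (hint2 a))
      (integrable_of_abs_le hh.measurable_ghostGap (abs_ghostGap_le h)) hpoint)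
    rw [integral_finsetSum _ fun a _ => (hint1 a).sub (hint2 a)]
    have hterm : ∀ a : Fin m, ∫ w, (θ.auction.revenue (w a).1
        - (h (sampleOf fun a => (w a).1)).auction.revenue (w a).2) ∂Q
        = expectedRevenue D θ.auction - expectedLearnedRevenue D h m := fun a => by
      rw [integral_sub (hint1 a) (hint2 a), hfst, hh.integral_revenue_ghost D]
    refine Eq.trans ?_ (Finset.sum_congr rfl fun a _ => (hterm a).symm)
    rw [Finset.sum_const, Finset.card_univ, Fintype.card_fin, nsmul_eq_mul]
  have hsqrt : Real.sqrt (2 * m * Real.log K) = m * Real.sqrt (2 * Real.log K / m) := by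
    rw [show 2 * m * Real.log K = m ^ 2 * (2 * Real.log K / m) by field_simp,
      Real.sqrt_mul (by positivity), Real.sqrt_sq hm'.le]
  rw [hsqrt] at hkey
  have := le_of_mul_le_mul_left hkey hm'
  linarith

/-- Empirical revenue maximization against the best level auction. -/
theorem IsERM.levelOPT_sub_le (hh : IsERM h) (hn : 1 ≤ n) (hs : 2 ≤ s) (hm : 1 ≤ m)
    (D : Fin n → Measure unitInterval) [∀ i, IsProbabilityMeasure (D i)] :
    levelOPT s D - Real.sqrt (2 * (n : ℝ) * (s : ℝ) * Real.log (2 * (m : ℝ)) / (m : ℝ))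
      ≤ expectedLearnedRevenue D h m := by
  -- The growth rate is taken at the size `2m` of the double sample, so `K = (2m)^(ns)`.
  have hlog : 2 * (n : ℝ) * (s : ℝ) * Real.log (2 * (m : ℝ))
      = 2 * Real.log (((2 * m) ^ (n * s) : ℕ) : ℝ) := by
    push_cast
    rw [Real.log_pow]
    push_cast
    ring
  rw [sub_le_iff_le_add]
  refine ciSup_le fun θ => ?_
  rw [← sub_le_iff_le_add, hlog]
  refine hh.expectedRevenue_sub_le hm (Nat.one_lt_pow ?_ (by omega))
    (hh.growthRate_le hn hs (by omega)) D θ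
  exact Nat.mul_ne_zero (by omega) (by omega)

end GhostSample

end LevelAuctions

/-! ### Price ladders for a single bidder -/

namespace LevelAuctions

section SingleBidder

open Filter Topology

/-- The probability that a bidder accepts the price `t`. -/
def demand (μ : Measure unitInterval) (t : unitInterval) : ℝ := μ.real (Set.Ici t)

/-- Optimal prices for the opportunity costs `0, 1/s, 2/s, …, 1`. -/
structure IsPriceLadder (μ : Measure unitInterval) (s : ℕ) (τ : ℕ → unitInterval) : Prop where
  mono : Monotone τ
  optimal : ∀ k ≤ s, ∀ u : unitInterval,
    ((u : ℝ) - k / s) * demand μ u ≤ (τ k - k / s) * demand μ (τ k)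
  top : τ s = 1

/-- The profit at the `k`-th price, when the item is worth `k / s` to the seller. -/
def ladderProfit (μ : Measure unitInterval) (s : ℕ) (τ : ℕ → unitInterval) (k : ℕ) : ℝ :=
  (τ k - k / s) * demand μ (τ k)

/-- The level of a value in a price ladder, as a fraction of `s`. -/
def ladderValue (s : ℕ) (τ : ℕ → unitInterval) (v : unitInterval) : ℝ :=
  1 / s * ∑ k ∈ Finset.range s, (Set.Ici (τ k)).indicator 1 v

section Ladder

variable {μ : Measure unitInterval} {s : ℕ} {τ : ℕ → unitInterval}

theorem IsPriceLadder.ladderProfit_top (hτ : IsPriceLadder μ s τ) (hs : 1 ≤ s) :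
    ladderProfit μ s τ s = 0 := by
  have hs0 : (s : ℝ) ≠ 0 := by exact_mod_cast (by omega : s ≠ 0)
  simp [ladderProfit, hτ.top, div_self hs0]

/-- The price `τ j` is also available at cost `(j + 1)/s`, where it earns `demand μ (τ j) / s` less.
The comparison telescopes down from profit `0` at the top; `d` counts the rungs left. -/
theorem IsPriceLadder.ladderProfit_le (hτ : IsPriceLadder μ s τ) (hs : 1 ≤ s) :
    ∀ d j, j + d = s → ladderProfit μ s τ j ≤ 1 / s * ∑ k ∈ Finset.Ico j s, demand μ (τ k) := by
  have hs0 : (0 : ℝ) < s := by exact_mod_cast hs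
  intro d
  induction d with
  | zero =>
    intro j hj
    obtain rfl : j = s := by omega
    simp [hτ.ladderProfit_top hs]
  | succ d ih =>
    intro j hj
    have h1 := ih (j + 1) (by omega)
    have h2 := hτ.optimal (j + 1) (by omega) (τ j)
    rw [Finset.sum_eq_sum_Ico_succ_bot (by omega), mul_add]
    unfold ladderProfit at h1 ⊢
    push_cast at h1 h2
    have h3 : ((τ j : ℝ) - j / s) * demand μ (τ j)
        = (τ j - (j + 1) / s) * demand μ (τ j) + 1 / s * demand μ (τ j) := by ring
    linarith

/-- The mirror image of `IsPriceLadder.ladderProfit_le`: now `τ (j + 1)` is tried at the lower cost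
`j/s`, which shifts the sum by one rung. -/
theorem IsPriceLadder.le_ladderProfit (hτ : IsPriceLadder μ s τ) (hs : 1 ≤ s) :
    ∀ d j, j + d = s →
      1 / s * ∑ k ∈ Finset.Ico (j + 1) (s + 1), demand μ (τ k) ≤ ladderProfit μ s τ j := by
  have hs0 : (0 : ℝ) < s := by exact_mod_cast hs
  intro d
  induction d with
  | zero =>
    intro j hj
    obtain rfl : j = s := by omega
    simp [hτ.ladderProfit_top hs]
  | succ d ih =>
    intro j hj
    have h1 := ih (j + 1) (by omega)
    have h2 := hτ.optimal j (by omega) (τ (j + 1))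
    rw [Finset.sum_eq_sum_Ico_succ_bot (by omega), mul_add]
    unfold ladderProfit at h1 ⊢
    push_cast at h1 h2
    have h3 : ((τ (j + 1) : ℝ) - j / s) * demand μ (τ (j + 1))
        = (τ (j + 1) - (j + 1) / s) * demand μ (τ (j + 1)) + 1 / s * demand μ (τ (j + 1)) := by
      ring
    linarith

/-- The revenue of any posted price is at most the expected level of the served values. -/
theorem IsPriceLadder.mul_demand_le (hτ : IsPriceLadder μ s τ) (hs : 1 ≤ s) (t : unitInterval) :
    t * demand μ t ≤ 1 / s * ∑ k ∈ Finset.range s, demand μ (max (τ k) t) := by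
  have hs0 : (0 : ℝ) < s := by exact_mod_cast hs
  have hex : ∃ k, t ≤ τ k := ⟨s, by rw [hτ.top]; exact unitInterval.le_one'⟩
  classical
  -- At the first rung `j` with `t ≤ τ j`, the revenue of `t` is its profit at cost `j/s`, at most
  -- `ladderProfit μ s τ j`, plus `j/s` times its demand, which is the share of the rungs below `j`.
  set j := Nat.find hex with hj
  have hjs : j ≤ s := Nat.find_min' hex (by rw [hτ.top]; exact unitInterval.le_one')
  have hlow : ∀ k ∈ Finset.range j, demand μ (max (τ k) t) = demand μ t := fun k hk => by
    rw [max_eq_right (not_le.1 (Nat.find_min hex (Finset.mem_range.1 hk))).le]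
  have hhigh : ∀ k ∈ Finset.Ico j s, demand μ (max (τ k) t) = demand μ (τ k) := fun k hk => by
    rw [max_eq_left ((Nat.find_spec hex).trans (hτ.mono (Finset.mem_Ico.1 hk).1))]
  rw [← Finset.sum_range_add_sum_Ico _ hjs, Finset.sum_congr rfl hlow, Finset.sum_congr rfl hhigh,
    Finset.sum_const, Finset.card_range, nsmul_eq_mul, mul_add]
  have h1 := hτ.ladderProfit_le hs (s - j) j (by omega)
  have h2 := hτ.optimal j hjs t
  unfold ladderProfit at h1
  have h3 : (t : ℝ) * demand μ t = (t - j / s) * demand μ t + 1 / s * (j * demand μ t) := by ring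
  linarith

theorem measurable_ladderValue : Measurable (ladderValue s τ) :=
  (Finset.measurable_sum _ fun _ _ => measurable_one.indicator measurableSet_Ici).const_mul _

theorem ladderValue_nonneg (v : unitInterval) : 0 ≤ ladderValue s τ v :=
  mul_nonneg (by positivity)
    (Finset.sum_nonneg fun _ _ => Set.indicator_nonneg (fun _ _ => zero_le_one) _)

theorem ladderValue_le_one (v : unitInterval) : ladderValue s τ v ≤ 1 := by
  have h : ∑ k ∈ Finset.range s, (Set.Ici (τ k)).indicator (1 : unitInterval → ℝ) v ≤ s := by
    refine (Finset.sum_le_sum fun k _ => Set.indicator_le_self' (fun _ _ => zero_le_one) v).trans ?_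
    simp
  unfold ladderValue
  rw [one_div_mul_eq_div]
  exact div_le_one_of_le₀ h (Nat.cast_nonneg _)

theorem IsPriceLadder.mul_demand_le_integral [IsProbabilityMeasure μ] (hτ : IsPriceLadder μ s τ)
    (hs : 1 ≤ s) (t : unitInterval) :
    t * μ.real (Set.Ici t) ≤ ∫ v in Set.Ici t, ladderValue s τ v ∂μ := by
  refine (hτ.mul_demand_le hs t).trans (le_of_eq ?_)
  unfold ladderValue
  have hint : ∀ k, Integrable ((Set.Ici (τ k)).indicator (1 : unitInterval → ℝ))
      (μ.restrict (Set.Ici t)) := fun k =>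
    (integrable_const (1 : ℝ)).indicator measurableSet_Ici
  rw [integral_const_mul, integral_finsetSum _ fun k _ => hint k]
  refine congrArg _ (Finset.sum_congr rfl fun k _ => ?_)
  rw [integral_indicator_one measurableSet_Ici, measureReal_restrict_apply measurableSet_Ici,
    Set.Ici_inter_Ici]
  rfl

end Ladder

variable (μ : Measure unitInterval)

theorem demand_nonneg (t : unitInterval) : 0 ≤ demand μ t := measureReal_nonneg

variable [IsProbabilityMeasure μ]

theorem demand_le_one (t : unitInterval) : demand μ t ≤ 1 := measureReal_le_one

theorem demand_antitone : Antitone (demand μ) := fun _ _ h =>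
  measureReal_mono (Set.Ici_subset_Ici.2 h)

/-- Demand is antitone and, by continuity of the measure from above, left continuous; an atom only
makes it drop to the right. -/
theorem upperSemicontinuous_demand : UpperSemicontinuous (demand μ) := by
  intro t y hy
  rcases eq_or_lt_of_le (unitInterval.nonneg' (t := t)) with h0 | h0
  · refine Eventually.of_forall fun u => lt_of_le_of_lt (demand_antitone μ ?_) hy
    rw [← h0]
    exact unitInterval.nonneg'
  · obtain ⟨u, hu, hut, hlim⟩ := exists_seq_strictMono_tendsto' h0
    have hInter : ⋂ k, Set.Ici (u k) = Set.Ici t := by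
      ext x
      simp only [Set.mem_iInter, Set.mem_Ici]
      exact ⟨fun h => le_of_tendsto' hlim h, fun h k => (hut k).2.le.trans h⟩
    have htend : Tendsto (fun k => demand μ (u k)) atTop (𝓝 (demand μ t)) := by
      have h1 := tendsto_measure_iInter_atTop (μ := μ) (s := fun k => Set.Ici (u k))
        (fun k => measurableSet_Ici.nullMeasurableSet)
        (fun k l hkl => Set.Ici_subset_Ici.2 (hu.monotone hkl)) ⟨0, measure_ne_top _ _⟩
      rw [hInter] at h1
      exact (ENNReal.tendsto_toReal (measure_ne_top _ _)).comp h1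
    obtain ⟨k, hk⟩ := (htend.eventually (gt_mem_nhds hy)).exists
    filter_upwards [lt_mem_nhds (hut k).2] with x hx
    exact lt_of_le_of_lt (demand_antitone μ hx.le) hk

theorem upperSemicontinuous_margin (l : ℝ) (hl : 0 ≤ l) :
    UpperSemicontinuous fun t : unitInterval => max ((t : ℝ) - l) 0 * demand μ t := by
  intro t y hy
  have hd1 := demand_le_one μ t
  have hd0 := demand_nonneg μ t
  have ha0 : 0 ≤ max ((t : ℝ) - l) 0 := le_max_right _ _
  have ha1 : max ((t : ℝ) - l) 0 ≤ 1 := by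
    have := unitInterval.le_one t
    exact max_le (by linarith) zero_le_one
  -- Both factors are at most `1`, so enlarging each by `δ ≤ 1` adds at most `3δ` to the product,
  -- less than the available gap.
  set δ := min 1 ((y - max ((t : ℝ) - l) 0 * demand μ t) / 4) with hδ
  have hδ0 : 0 < δ := lt_min one_pos (by simp only at hy; linarith)
  have hδ1 : δ ≤ 1 := min_le_left _ _
  have hδ2 : δ ≤ (y - max ((t : ℝ) - l) 0 * demand μ t) / 4 := min_le_right _ _
  have hcont : Continuous fun t : unitInterval => max ((t : ℝ) - l) 0 := by fun_prop
  have h1 : ∀ᶠ x : unitInterval in 𝓝 t, max ((x : ℝ) - l) 0 < max ((t : ℝ) - l) 0 + δ :=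
    hcont.continuousAt.eventually (gt_mem_nhds (by linarith))
  have h2 : ∀ᶠ x in 𝓝 t, demand μ x < demand μ t + δ :=
    upperSemicontinuous_demand μ t _ (by linarith)
  filter_upwards [h1, h2] with x hx1 hx2
  have h3 : max ((x : ℝ) - l) 0 * demand μ x
      ≤ (max ((t : ℝ) - l) 0 + δ) * (demand μ t + δ) :=
    mul_le_mul hx1.le hx2.le (demand_nonneg μ x) (by linarith)
  nlinarith

/-- There is a largest optimal price for selling an item that is worth `l` to the seller. -/
theorem exists_greatest_optimal_price {l : ℝ} (hl : 0 ≤ l) (hl1 : l ≤ 1) :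
    ∃ t : unitInterval, l ≤ t ∧
      (∀ u : unitInterval, ((u : ℝ) - l) * demand μ u ≤ (t - l) * demand μ t) ∧
      ∀ u : unitInterval, t < u → ((u : ℝ) - l) * demand μ u < (t - l) * demand μ t := by
  set f : unitInterval → ℝ := fun t => max ((t : ℝ) - l) 0 * demand μ t with hf
  have husc := upperSemicontinuous_margin μ l hl
  obtain ⟨t₀, -, ht₀⟩ := UpperSemicontinuousOn.exists_isMaxOn
    Set.univ_nonempty isCompact_univ (husc.upperSemicontinuousOn Set.univ)
  have hmax : ∀ u, f u ≤ f t₀ := fun u => ht₀ (Set.mem_univ u)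
  have hclosed : IsClosed (f ⁻¹' Set.Ici (f t₀)) :=
    upperSemicontinuous_iff_isClosed_preimage.1 husc _
  obtain ⟨t, ht, htop⟩ := hclosed.isCompact.exists_isGreatest ⟨t₀, le_refl (f t₀)⟩
  have hft : f t = f t₀ := le_antisymm (hmax t) ht
  -- If `t < l`, the truncated margin and hence the maximum are `0`; then `1` is a maximizer too,
  -- against `t` being the largest.
  have hlt : l ≤ t := by
    by_contra hlt
    push Not at hlt
    have h0 : f t = 0 := by
      simp only [hf]
      rw [max_eq_right (by linarith), zero_mul]
    have h1 : (1 : unitInterval) ≤ t := by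
      refine htop (show f t₀ ≤ f 1 from ?_)
      rw [← hft, h0]
      exact mul_nonneg (le_max_right _ _) (demand_nonneg μ _)
    have h2 : (1 : ℝ) ≤ t := h1
    linarith
  have hft' : f t = (t - l) * demand μ t := by
    simp only [hf]
    rw [max_eq_left (by linarith)]
  have hle : ∀ u : unitInterval, ((u : ℝ) - l) * demand μ u ≤ f u := fun u =>
    mul_le_mul_of_nonneg_right (le_max_left _ _) (demand_nonneg μ u)
  refine ⟨t, hlt, fun u => ?_, fun u hu => ?_⟩
  · rw [← hft', hft]
    exact (hle u).trans (hmax u)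
  · rw [← hft', hft]
    refine lt_of_le_of_lt (hle u) (lt_of_not_ge fun h => ?_)
    exact absurd (htop h) hu.not_ge

/-- Monotonicity is revealed preference: if the price dropped as the cost rose, adding the two
optimality inequalities, one strict by the choice of the largest optimum, would contradict that
demand is antitone. -/
theorem exists_isPriceLadder {s : ℕ} (hs : 1 ≤ s) : ∃ τ, IsPriceLadder μ s τ := by
  have hs0 : (0 : ℝ) < s := by exact_mod_cast hs
  -- The cap at `1` keeps the cost admissible for `k > s`, where only monotonicity is required.
  let l : ℕ → ℝ := fun k => min ((k : ℝ) / s) 1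
  have hl0 : ∀ k, 0 ≤ l k := fun k => le_min (by positivity) zero_le_one
  have hl1 : ∀ k, l k ≤ 1 := fun k => min_le_right _ _
  choose τ hlτ hopt hgt using fun k => exists_greatest_optimal_price μ (hl0 k) (hl1 k)
  refine ⟨τ, fun k k' hk => ?_, fun k hk u => ?_, ?_⟩
  · by_contra hlt
    push Not at hlt
    have h1 := hopt k (τ k')
    have h2 := hgt k' (τ k) hlt
    have h3 := demand_antitone μ hlt.le
    have h4 : l k ≤ l k' := min_le_min_right _ (by gcongr)
    nlinarith
  · have hlk : l k = k / s := min_eq_left ((div_le_one hs0).2 (by exact_mod_cast hk))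
    have := hopt k u
    rwa [hlk] at this
  · have hls : l s = 1 := by simp [l, div_self hs0.ne']
    have := hlτ s
    rw [hls] at this
    exact le_antisymm unitInterval.le_one' this

end SingleBidder

/-! ### From posted prices to arbitrary truthful single-bidder mechanisms -/

section SingleBidderMechanism

open Filter Topology

variable {μ : Measure unitInterval} [IsProbabilityMeasure μ] {w : unitInterval → ℝ}

/-- A bound on all posted price revenues extends from closed to arbitrary upper sets of values. -/
theorem mul_measureReal_le_of_isUpperSet (hw : Measurable w) (hw0 : ∀ v, 0 ≤ w v)
    (hw1 : ∀ v, w v ≤ 1) (h : ∀ t : unitInterval, t * μ.real (Set.Ici t) ≤ ∫ v in Set.Ici t, w v ∂μ)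
    {U : Set unitInterval} (hU : IsUpperSet U) {a : ℝ} (ha : ∀ u ∈ U, a ≤ (u : ℝ)) :
    a * μ.real U ≤ ∫ v in U, w v ∂μ := by
  have hint : Integrable w μ := integrable_of_abs_le hw fun v => by
    rw [abs_of_nonneg (hw0 v)]
    exact hw1 v
  have hIci : ∀ u ∈ U, a * μ.real (Set.Ici u) ≤ ∫ v in U, w v ∂μ := fun u hu =>
    calc a * μ.real (Set.Ici u) ≤ u * μ.real (Set.Ici u) :=
          mul_le_mul_of_nonneg_right (ha u hu) measureReal_nonneg
      _ ≤ ∫ v in Set.Ici u, w v ∂μ := h u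
      _ ≤ ∫ v in U, w v ∂μ := setIntegral_mono_set hint.integrableOn
          (Eventually.of_forall hw0) (Eventually.of_forall fun x hx => hU hx hu)
  by_cases hmem : sInf U ∈ U
  · have : U = Set.Ici (sInf U) :=
      Set.Subset.antisymm (fun x hx => sInf_le hx) fun x hx => hU hx hmem
    have h1 := hIci _ hmem
    rwa [← this] at h1
  -- Without its infimum, a nonempty `U` is an increasing union of closed rays, and the bound passes
  -- to the limit.
  · rcases U.eq_empty_or_nonempty with rfl | ⟨y, hy⟩
    · simp
    have hlt : ∀ x ∈ U, sInf U < x := fun x hx =>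
      lt_of_le_of_ne (sInf_le hx) fun h => hmem (h ▸ hx)
    obtain ⟨u, hu, hut, hlim⟩ := exists_seq_strictAnti_tendsto' (hlt y hy)
    have huU : ∀ k, u k ∈ U := fun k => by
      obtain ⟨x, hx, hxu⟩ := sInf_lt_iff.1 (hut k).1
      exact hU hxu.le hx
    have hUnion : ⋃ k, Set.Ici (u k) = U := by
      refine Set.Subset.antisymm (Set.iUnion_subset fun k x hx => hU hx (huU k)) fun x hx => ?_
      obtain ⟨k, hk⟩ := (hlim.eventually (gt_mem_nhds (hlt x hx))).exists
      exact Set.mem_iUnion.2 ⟨k, hk.le⟩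
    have htend : Tendsto (fun k => μ.real (Set.Ici (u k))) atTop (𝓝 (μ.real U)) := by
      have h1 := tendsto_measure_iUnion_atTop (μ := μ) (s := fun k => Set.Ici (u k))
        fun k l hkl => Set.Ici_subset_Ici.2 (hu.antitone hkl)
      rw [hUnion] at h1
      exact (ENNReal.tendsto_toReal (measure_ne_top _ _)).comp h1
    exact le_of_tendsto' (htend.const_mul a) fun k => hIci _ (huU k)

theorem sum_indicator_succ_le {y : ℝ} (hy : 0 ≤ y) (N : ℕ) :
    (∑ j ∈ Finset.range N, if ((j : ℝ) + 1) ≤ y then (1 : ℝ) else 0) ≤ y := by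
  rw [Finset.sum_boole]
  refine le_trans (Nat.cast_le.2 ?_) (Nat.floor_le hy)
  rw [← Finset.card_range ⌊y⌋₊]
  refine Finset.card_le_card fun j hj => ?_
  rw [Finset.mem_range, ← Nat.succ_le_iff]
  exact Nat.le_floor (by exact_mod_cast (Finset.mem_filter.1 hj).2)

variable {x p : unitInterval → ℝ}

/-- The lowest value that wins with probability at least `c`. -/
def winInf (x : unitInterval → ℝ) (c : ℝ) : ℝ := sInf ((↑) '' {v : unitInterval | c ≤ x v})

theorem winInf_nonneg (x : unitInterval → ℝ) (c : ℝ) : 0 ≤ winInf x c :=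
  Real.sInf_nonneg (by rintro _ ⟨v, -, rfl⟩; exact unitInterval.nonneg v)

theorem winInf_le {c : ℝ} {v : unitInterval} (hv : c ≤ x v) : winInf x c ≤ v :=
  csInf_le ⟨0, by rintro _ ⟨v, -, rfl⟩; exact unitInterval.nonneg v⟩ ⟨v, hv, rfl⟩

/-- The witness `v` is needed because the infimum of the empty set is `0`. -/
theorem le_winInf {c a : ℝ} {v : unitInterval} (hv : c ≤ x v)
    (h : ∀ u : unitInterval, c ≤ x u → a ≤ u) : a ≤ winInf x c :=
  le_csInf ⟨_, v, hv, rfl⟩ (by rintro _ ⟨u, hu, rfl⟩; exact h u hu)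

theorem alloc_monotone
    (hic : ∀ v b : unitInterval, (v : ℝ) * x b - p b ≤ v * x v - p v) : Monotone x := by
  intro v b hvb
  rcases eq_or_lt_of_le hvb with rfl | hlt
  · exact le_rfl
  · have h1 := hic v b
    have h2 := hic b v
    have h3 : (v : ℝ) < b := hlt
    by_contra hx
    push Not at hx
    nlinarith

/-- The utility of a truthful bidder is at least the area under a step function below his
winning probability. -/
theorem sum_le_utility (hic : ∀ v b : unitInterval, (v : ℝ) * x b - p b ≤ v * x v - p v)
    (hir : ∀ v : unitInterval, 0 ≤ (v : ℝ) * x v - p v) {N : ℕ} (hN : 0 < N) (k : ℕ) :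
    ∀ v : unitInterval, (k : ℝ) / N ≤ x v →
      ∑ j ∈ Finset.range k, ((v : ℝ) - winInf x ((j + 1 : ℝ) / N)) / N ≤ v * x v - p v := by
  have hN0 : (0 : ℝ) < N := by exact_mod_cast hN
  induction k with
  | zero =>
    intro v _
    simpa using hir v
  | succ k ih =>
    intro v hv
    push_cast at hv
    have hstep : (k : ℝ) / N ≤ (k + 1) / N := by gcongr; linarith
    rw [Finset.sum_range_succ]
    set S : unitInterval → ℝ := fun v =>
      ∑ j ∈ Finset.range k, ((v : ℝ) - winInf x ((j + 1 : ℝ) / N)) / N with hS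
    have hSsub : ∀ v u : unitInterval, S v - S u = (v - u) * (k / N) := fun v u => by
      simp only [hS]
      rw [← Finset.sum_sub_distrib]
      have : ∀ j ∈ Finset.range k, ((v : ℝ) - winInf x ((j + 1 : ℝ) / N)) / N
          - ((u : ℝ) - winInf x ((j + 1 : ℝ) / N)) / N = (v - u) / N := fun j _ => by ring
      rw [Finset.sum_congr rfl this, Finset.sum_const, Finset.card_range, nsmul_eq_mul]
      ring
    have hv' := ih v (hstep.trans hv)
    -- For `u ≤ v` winning with probability at least `(k + 1)/N`, truthfulness gives `v` at least
    -- the utility of `u` plus `(v - u)(k + 1)/N`. The first `k` layers account for `(v - u) k/N`,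
    -- leaving `(v - u)/N` for the new one; then take the infimum over `u`.
    have hbound : (v : ℝ) - N * (v * x v - p v - S v) ≤ winInf x ((k + 1 : ℝ) / N) := by
      refine le_winInf hv fun u hu => ?_
      suffices h : ((v : ℝ) - u) / N ≤ v * x v - p v - S v by
        rw [div_le_iff₀ hN0] at h
        linarith
      rcases le_total v u with huv | huv
      · have h1 : (v : ℝ) ≤ u := huv
        have h2 : ((v : ℝ) - u) / N ≤ 0 := div_nonpos_of_nonpos_of_nonneg (by linarith) hN0.le
        have h3 : S v ≤ v * x v - p v := hv'
        linarith
      · have h1 : (u : ℝ) ≤ v := huv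
        have h2 := hic v u
        have h3 : S u ≤ u * x u - p u := ih u (hstep.trans hu)
        have h4 := hSsub v u
        have h5 : ((v : ℝ) - u) * ((k + 1) / N) ≤ (v - u) * x u :=
          mul_le_mul_of_nonneg_left hu (by linarith)
        have h6 : ((v : ℝ) - u) * ((k + 1) / N) = (v - u) * (k / N) + (v - u) / N := by ring
        linarith
    have h7 : ((v : ℝ) - winInf x ((k + 1 : ℝ) / N)) / N ≤ v * x v - p v - S v := by
      rw [div_le_iff₀ hN0]
      linarith
    have h8 : S v + ((v : ℝ) - winInf x ((k + 1 : ℝ) / N)) / N ≤ v * x v - p v := by linarith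
    exact h8

/-- A payment is surplus minus utility. Rounding the winning probability to the grid `1/N` costs at
most `1/N` of surplus, and the utility bound turns the remainder into an average of the posted
prices of the layers reached. -/
theorem pay_le_sum (hx0 : ∀ v, 0 ≤ x v) (hx1 : ∀ v, x v ≤ 1)
    (hic : ∀ v b : unitInterval, (v : ℝ) * x b - p b ≤ v * x v - p v)
    (hir : ∀ v : unitInterval, 0 ≤ (v : ℝ) * x v - p v) {N : ℕ} (hN : 0 < N) (v : unitInterval) :
    p v ≤ 1 / N + 1 / N * ∑ j ∈ Finset.range N,
      {v | (j + 1 : ℝ) / N ≤ x v}.indicator (fun _ => winInf x ((j + 1 : ℝ) / N)) v := by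
  have hN0 : (0 : ℝ) < N := by exact_mod_cast hN
  set k := ⌊N * x v⌋₊ with hk
  have hk1 : (k : ℝ) / N ≤ x v := by
    rw [div_le_iff₀ hN0, mul_comm]
    exact Nat.floor_le (mul_nonneg hN0.le (hx0 v))
  have hk2 : x v ≤ (k + 1) / N := by
    rw [le_div_iff₀ hN0, mul_comm]
    exact (Nat.lt_floor_add_one _).le
  have hkN : k ≤ N := by
    have : (k : ℝ) ≤ N := by
      rw [div_le_iff₀ hN0] at hk1
      exact hk1.trans (mul_le_of_le_one_left hN0.le (hx1 v))
    exact_mod_cast this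
  have hu := sum_le_utility hic hir hN k v hk1
  have hsum : ∑ j ∈ Finset.range k, ((v : ℝ) - winInf x ((j + 1 : ℝ) / N)) / N
      = v * (k / N) - 1 / N * ∑ j ∈ Finset.range k, winInf x ((j + 1 : ℝ) / N) := by
    rw [← Finset.sum_div, Finset.sum_sub_distrib, Finset.sum_const, Finset.card_range,
      nsmul_eq_mul]
    ring
  have hle : ∑ j ∈ Finset.range k, winInf x ((j + 1 : ℝ) / N) ≤ ∑ j ∈ Finset.range N,
      {v | (j + 1 : ℝ) / N ≤ x v}.indicator (fun _ => winInf x ((j + 1 : ℝ) / N)) v := by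
    refine le_trans (Finset.sum_le_sum fun j hj => ?_) (Finset.sum_le_sum_of_subset_of_nonneg
      (Finset.range_mono hkN) fun j _ _ => Set.indicator_nonneg (fun _ _ => winInf_nonneg _ _) _)
    rw [Set.indicator_of_mem]
    have : (j + 1 : ℝ) ≤ k := by exact_mod_cast Finset.mem_range.1 hj
    exact le_trans (by gcongr) hk1
  have hv0 := unitInterval.nonneg v
  have hv1 := unitInterval.le_one v
  have h1 : (v : ℝ) * x v ≤ v * ((k + 1) / N) := mul_le_mul_of_nonneg_left hk2 hv0
  have h2 : (v : ℝ) * ((k + 1) / N) = v * (k / N) + v * (1 / N) := by ring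
  have h3 : (v : ℝ) * (1 / N) ≤ 1 / N := mul_le_of_le_one_left (by positivity) hv1
  have h4 : 1 / (N : ℝ) * ∑ j ∈ Finset.range k, winInf x ((j + 1 : ℝ) / N) ≤ 1 / N *
      ∑ j ∈ Finset.range N,
        {v | (j + 1 : ℝ) / N ≤ x v}.indicator (fun _ => winInf x ((j + 1 : ℝ) / N)) v := by
    gcongr
  linarith

/-- If the revenue of every posted price is at most the expected weight of the served values, then
so is the revenue of every truthful mechanism for a single bidder. -/
theorem integral_pay_le (hw : Measurable w) (hw0 : ∀ v, 0 ≤ w v) (hw1 : ∀ v, w v ≤ 1)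
    (h : ∀ t : unitInterval, t * μ.real (Set.Ici t) ≤ ∫ v in Set.Ici t, w v ∂μ)
    (hxm : Measurable x) (hpm : Measurable p) (hp : ∀ v, |p v| ≤ 1)
    (hx0 : ∀ v, 0 ≤ x v) (hx1 : ∀ v, x v ≤ 1)
    (hic : ∀ v b : unitInterval, (v : ℝ) * x b - p b ≤ v * x v - p v)
    (hir : ∀ v : unitInterval, 0 ≤ (v : ℝ) * x v - p v) :
    ∫ v, p v ∂μ ≤ ∫ v, w v * x v ∂μ := by
  have hwint : Integrable w μ := integrable_of_abs_le hw fun v => by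
    rw [abs_of_nonneg (hw0 v)]
    exact hw1 v
  have hwx : Integrable (fun v => w v * x v) μ :=
    integrable_of_abs_le (c := 1) (hw.mul hxm) fun v => by
      rw [abs_of_nonneg (mul_nonneg (hw0 v) (hx0 v))]
      exact mul_le_one₀ (hw1 v) (hx0 v) (hx1 v)
  refine le_of_forall_pos_le_add fun ε hε => ?_
  obtain ⟨N', hN'⟩ := exists_nat_one_div_lt hε
  set N := N' + 1 with hNdef
  have hN : 0 < N := Nat.succ_pos _
  have hN0 : (0 : ℝ) < N := by exact_mod_cast hN
  have hNε : 1 / (N : ℝ) < ε := by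
    rw [hNdef]
    push_cast
    exact hN'
  -- The layers of the allocation are upper sets because truthfulness makes it monotone; each one
  -- acts as a posted price.
  let U : ℕ → Set unitInterval := fun j => {v | (j + 1 : ℝ) / N ≤ x v}
  have hUm : ∀ j, MeasurableSet (U j) := fun j => measurableSet_le measurable_const hxm
  have hUup : ∀ j, IsUpperSet (U j) := fun j a b hab ha => le_trans ha (alloc_monotone hic hab)
  have hind : ∀ j, Integrable ((U j).indicator fun _ => winInf x ((j + 1 : ℝ) / N)) μ := fun j =>
    (integrable_const _).indicator (hUm j)
  have hwind : ∀ j, Integrable ((U j).indicator w) μ := fun j => hwint.indicator (hUm j)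
  have hpoint : ∀ v, 1 / (N : ℝ) * ∑ j ∈ Finset.range N, (U j).indicator w v ≤ w v * x v := by
    intro v
    have h1 : ∑ j ∈ Finset.range N, (U j).indicator w v
        = w v * ∑ j ∈ Finset.range N, if ((j : ℝ) + 1) ≤ N * x v then (1 : ℝ) else 0 := by
      rw [Finset.mul_sum]
      refine Finset.sum_congr rfl fun j _ => ?_
      have hiff : v ∈ U j ↔ ((j : ℝ) + 1) ≤ N * x v := by
        change (j + 1 : ℝ) / N ≤ x v ↔ _
        rw [div_le_iff₀ hN0, mul_comm]
      by_cases hv : v ∈ U j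
      · rw [Set.indicator_of_mem hv, if_pos (hiff.1 hv), mul_one]
      · rw [Set.indicator_of_notMem hv, if_neg (fun hc => hv (hiff.2 hc)), mul_zero]
    have h2 := sum_indicator_succ_le (mul_nonneg hN0.le (hx0 v)) N
    rw [h1]
    calc 1 / (N : ℝ) * (w v * ∑ j ∈ Finset.range N, if ((j : ℝ) + 1) ≤ N * x v then (1 : ℝ) else 0)
        ≤ 1 / N * (w v * (N * x v)) := by
          have := hw0 v
          gcongr
      _ = w v * x v := by field_simp
  calc ∫ v, p v ∂μ
      ≤ ∫ v, (1 / N + 1 / N * ∑ j ∈ Finset.range N,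
          (U j).indicator (fun _ => winInf x ((j + 1 : ℝ) / N)) v) ∂μ :=
        integral_mono (integrable_of_abs_le hpm hp)
          ((integrable_const _).add ((integrable_finsetSum _ fun j _ => hind j).const_mul _))
          (pay_le_sum hx0 hx1 hic hir hN)
    _ = 1 / N + 1 / N * ∑ j ∈ Finset.range N, winInf x ((j + 1 : ℝ) / N) * μ.real (U j) := by
        rw [integral_add (integrable_const _)
          ((integrable_finsetSum _ fun j _ => hind j).const_mul _), integral_const_mul,
          integral_finsetSum _ fun j _ => hind j]
        simp [integral_indicator_const _ (hUm _), mul_comm]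
    _ ≤ 1 / N + 1 / N * ∑ j ∈ Finset.range N, ∫ v in U j, w v ∂μ := by
        gcongr with j _
        exact mul_measureReal_le_of_isUpperSet hw hw0 hw1 h (hUup j) fun u hu => winInf_le hu
    _ = 1 / N + ∫ v, 1 / N * ∑ j ∈ Finset.range N, (U j).indicator w v ∂μ := by
        rw [integral_const_mul, integral_finsetSum _ fun j _ => hwind j]
        simp only [integral_indicator (hUm _)]
    _ ≤ 1 / N + ∫ v, w v * x v ∂μ := by
        refine add_le_add le_rfl ?_
        exact integral_mono ((integrable_finsetSum _ fun j _ => hwind j).const_mul _) hwx hpoint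
    _ ≤ ∫ v, w v * x v ∂μ + ε := by linarith

end SingleBidderMechanism

end LevelAuctions

/-! ### Level auctions approximate the optimal auction -/

namespace LevelAuctions

variable {n : ℕ}

/-- Redrawing one value leaves the distribution of the profile unchanged. -/
theorem measurePreserving_update (D : Fin n → Measure unitInterval)
    [∀ i, IsProbabilityMeasure (D i)] (i : Fin n) :
    MeasurePreserving (fun q : Profile n × unitInterval => Function.update q.1 i q.2)
      ((Measure.pi D).prod (D i)) (Measure.pi D) := by
  have hmeas : Measurable fun q : Profile n × unitInterval => Function.update q.1 i q.2 := by
    refine measurable_pi_lambda _ fun k => ?_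
    by_cases hk : k = i
    · subst hk
      simpa using measurable_snd
    · simp only [Function.update_of_ne hk]
      exact (measurable_pi_apply k).comp measurable_fst
  refine ⟨hmeas, (Measure.pi_eq fun S hS => ?_).symm⟩
  rw [Measure.map_apply hmeas (MeasurableSet.univ_pi hS)]
  have hpre : (fun q : Profile n × unitInterval => Function.update q.1 i q.2) ⁻¹' Set.univ.pi S
      = Set.univ.pi (Function.update S i Set.univ) ×ˢ S i := by
    ext ⟨v, b⟩
    simp only [Set.mem_preimage, Set.mem_pi, Set.mem_univ, true_implies, Set.mem_prod]
    constructor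
    · intro h
      refine ⟨fun k => ?_, by simpa using h i⟩
      by_cases hk : k = i
      · subst hk
        simp
      · simpa [Function.update_of_ne hk] using h k
    · rintro ⟨h, hb⟩ k
      by_cases hk : k = i
      · subst hk
        simpa using hb
      · simpa [Function.update_of_ne hk] using h k
  rw [hpre, Measure.prod_prod, Measure.pi_pi, ← Finset.mul_prod_erase _ _ (Finset.mem_univ i),
    ← Finset.mul_prod_erase (Finset.univ) (fun k => D k (S k)) (Finset.mem_univ i)]
  rw [Function.update_self, measure_univ, one_mul, mul_comm]
  congr 1
  refine Finset.prod_congr rfl fun k hk => ?_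
  rw [Function.update_of_ne (Finset.ne_of_mem_erase hk)]

/-- Independence enters here: redrawing bidder `i`'s value preserves the law, so single-bidder
inequalities for fixed reports of the others integrate. -/
theorem integral_le_integral_of_update (D : Fin n → Measure unitInterval)
    [∀ i, IsProbabilityMeasure (D i)] (i : Fin n) {f g : Profile n → ℝ} (hf : Measurable f)
    (hg : Measurable g) (hf1 : ∀ v, |f v| ≤ 1) (hg1 : ∀ v, |g v| ≤ 1)
    (h : ∀ v, ∫ b, f (Function.update v i b) ∂(D i) ≤ ∫ b, g (Function.update v i b) ∂(D i)) :
    ∫ v, f v ∂(Measure.pi D) ≤ ∫ v, g v ∂(Measure.pi D) := by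
  have hmp := measurePreserving_update D i
  have hfi : Integrable (fun q : Profile n × unitInterval => f (Function.update q.1 i q.2))
      ((Measure.pi D).prod (D i)) :=
    integrable_of_abs_le (hf.comp hmp.measurable) fun q => hf1 _
  have hgi : Integrable (fun q : Profile n × unitInterval => g (Function.update q.1 i q.2))
      ((Measure.pi D).prod (D i)) :=
    integrable_of_abs_le (hg.comp hmp.measurable) fun q => hg1 _
  rw [← integral_comp_measurePreserving hmp hf, ← integral_comp_measurePreserving hmp hg,
    integral_prod _ hfi, integral_prod _ hgi]
  exact integral_mono hfi.integral_prod_left hgi.integral_prod_left h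

section Upper

variable {A : Auction n} {s : ℕ}

theorem Auction.IsTruthful.alloc_le_one (hA : A.IsTruthful) (v : Profile n) (i : Fin n) :
    A.alloc v i ≤ 1 :=
  (Finset.single_le_sum (fun k _ => hA.alloc_nonneg v k) (Finset.mem_univ i)).trans
    (hA.alloc_sum_le_one v)

/-- The payments of a bidder in a truthful auction are bounded by the expected level of his value
when he wins. -/
theorem Auction.IsTruthful.integral_pay_le (hA : A.IsTruthful) (D : Fin n → Measure unitInterval)
    [∀ i, IsProbabilityMeasure (D i)] (hs : 1 ≤ s) (i : Fin n) {τ : ℕ → unitInterval}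
    (hτ : IsPriceLadder (D i) s τ) :
    ∫ v, A.pay v i ∂(Measure.pi D)
      ≤ ∫ v, ladderValue s τ (v i) * A.alloc v i ∂(Measure.pi D) := by
  have habs : ∀ v, |A.pay v i| ≤ 1 := fun v =>
    abs_le.2 ⟨hA.neg_one_le_pay v i, hA.pay_le_one v i⟩
  refine integral_le_integral_of_update D i (hA.measurable_pay i)
    ((measurable_ladderValue.comp (measurable_pi_apply i)).mul (hA.measurable_alloc i)) habs
    (fun v => ?_) fun v => ?_
  · rw [abs_of_nonneg (mul_nonneg (ladderValue_nonneg _) (hA.alloc_nonneg v i))]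
    exact mul_le_one₀ (ladderValue_le_one _) (hA.alloc_nonneg v i) (hA.alloc_le_one v i)
  · simp only [Function.update_self]
    refine LevelAuctions.integral_pay_le (x := fun b => A.alloc (Function.update v i b) i)
      (p := fun b => A.pay (Function.update v i b) i) measurable_ladderValue ladderValue_nonneg
      ladderValue_le_one (hτ.mul_demand_le_integral hs)
      ((hA.measurable_alloc i).comp (measurable_update v))
      ((hA.measurable_pay i).comp (measurable_update v)) (fun b => habs _)
      (fun b => hA.alloc_nonneg _ i) (fun b => hA.alloc_le_one _ i) (fun a b => ?_) fun b => ?_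
    · simpa using hA.truthful (Function.update v i a) i b
    · simpa using hA.individually_rational (Function.update v i b) i

end Upper

section Lower

variable {s : ℕ}

/-- The level auction with the given price ladders as thresholds. -/
def ladderThresholds (s : ℕ) (τ : Fin n → ℕ → unitInterval) (hτ : ∀ i, Monotone (τ i)) :
    Thresholds n s where
  threshold i j := τ i j
  mono i _ _ hjk := hτ i hjk

variable {τ : Fin n → ℕ → unitInterval} {hτ : ∀ i, Monotone (τ i)}

/-- The rungs `0, …, s` become the thresholds of the indices `1, …, s + 1`; the last, conventional
threshold `1` is the rung `τ i s`. -/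
theorem fullThreshold_ladderThresholds {i : Fin n} (htop : τ i s = 1) {k : ℕ} (hk : k ≤ s) :
    (ladderThresholds s τ hτ).fullThreshold i (k + 1) = τ i k := by
  rcases eq_or_lt_of_le hk with rfl | hlt
  · rw [Thresholds.fullThreshold_of_lt _ _ (Nat.lt_succ_self _), htop]
  · exact Thresholds.fullThreshold_succ _ i ⟨k, hlt⟩

theorem lt_index_ladderThresholds_iff {i : Fin n} (htop : τ i s = 1) {k : ℕ} (hk : k ≤ s)
    (b : unitInterval) : k < (ladderThresholds s τ hτ).index i b ↔ τ i k ≤ b := by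
  rw [← fullThreshold_ladderThresholds (hτ := hτ) htop hk,
    ← Thresholds.le_index_iff _ _ _ (Nat.succ_le_succ hk), Nat.succ_le_iff]

theorem indicator_Ici_ladder {i : Fin n} (htop : τ i s = 1) {k : ℕ} (hk : k ≤ s)
    (b : unitInterval) : (Set.Ici (τ i k)).indicator (1 : unitInterval → ℝ) b
      = if k < (ladderThresholds s τ hτ).index i b then 1 else 0 := by
  classical
  rw [Set.indicator_apply]
  simp only [lt_index_ladderThresholds_iff htop hk, Set.mem_Ici, Pi.one_apply]

theorem ladderValue_le_index {i : Fin n} (htop : τ i s = 1) (b : unitInterval) :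
    ladderValue s (τ i) b ≤ (ladderThresholds s τ hτ).index i b / s := by
  unfold ladderValue
  rw [one_div_mul_eq_div]
  refine div_le_div_of_nonneg_right ?_ (Nat.cast_nonneg _)
  rw [Finset.sum_congr rfl fun k hk => indicator_Ici_ladder (hτ := hτ) htop
    (Finset.mem_range.1 hk).le b, Finset.sum_boole]
  refine Nat.cast_le.2 ?_
  conv_rhs => rw [← Finset.card_range ((ladderThresholds s τ hτ).index i b)]
  exact Finset.card_le_card fun k hk => Finset.mem_range.2 (Finset.mem_filter.1 hk).2

/-- A bidder who reaches rung `j` has `index - 1` equal to `j` plus the number of rungs above `j`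
that he reaches. Integrating produces the sum in `IsPriceLadder.le_ladderProfit`. -/
theorem level_mul_indicator_eq {i : Fin n} (htop : τ i s = 1) {j : ℕ} (hj : j ≤ s)
    (b : unitInterval) :
    ((((ladderThresholds s τ hτ).index i b : ℝ) - 1) / s)
        * (Set.Ici (τ i j)).indicator (1 : unitInterval → ℝ) b
      = j / s * (Set.Ici (τ i j)).indicator (1 : unitInterval → ℝ) b
        + 1 / s * ∑ k ∈ Finset.Ico (j + 1) (s + 1),
          (Set.Ici (τ i k)).indicator (1 : unitInterval → ℝ) b := by
  have hle := (ladderThresholds s τ hτ).index_le i b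
  rw [Finset.sum_congr rfl fun k hk => indicator_Ici_ladder (hτ := hτ) htop
    (Nat.lt_succ_iff.1 (Finset.mem_Ico.1 hk).2) b, indicator_Ici_ladder (hτ := hτ) htop hj b,
    Finset.sum_boole]
  generalize (ladderThresholds s τ hτ).index i b = J at hle
  split_ifs with h
  · have hset : (Finset.Ico (j + 1) (s + 1)).filter (fun k => k < J) = Finset.Ico (j + 1) J := by
      ext k
      simp only [Finset.mem_filter, Finset.mem_Ico]
      omega
    rw [hset, Nat.card_Ico, Nat.cast_sub h]
    push_cast
    ring
  · have hset : (Finset.Ico (j + 1) (s + 1)).filter (fun k => k < J) = ∅ := by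
      ext k
      simp only [Finset.mem_filter, Finset.mem_Ico, Finset.notMem_empty, iff_false]
      omega
    rw [hset]
    simp

/-- The payments of a bidder in the level auction are at least the expected level of his value,
rounded down, when he wins. -/
theorem integral_level_mul_alloc_le (D : Fin n → Measure unitInterval)
    [∀ i, IsProbabilityMeasure (D i)] (hs : 1 ≤ s) (i : Fin n)
    (hlad : IsPriceLadder (D i) s (τ i)) :
    ∫ v, (((ladderThresholds s τ hτ).index i (v i) : ℝ) - 1) / s
        * (ladderThresholds s τ hτ).auction.alloc v i ∂(Measure.pi D)
      ≤ ∫ v, (ladderThresholds s τ hτ).auction.pay v i ∂(Measure.pi D) := by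
  set θ := ladderThresholds s τ hτ with hθ
  have hA := θ.auction_isTruthful
  have hs0 : (0 : ℝ) < s := by exact_mod_cast hs
  have hidx : Measurable fun v : Profile n => (θ.index i (v i) : ℝ) :=
    (measurable_of_countable (fun k : ℕ => (k : ℝ))).comp
      (Thresholds.measurable_index (fun _ _ => measurable_const) measurable_id i)
  refine integral_le_integral_of_update D i
    (((hidx.sub_const 1).div_const _).mul (hA.measurable_alloc i)) (hA.measurable_pay i)
    (fun v => ?_) (fun v => abs_le.2 ⟨hA.neg_one_le_pay v i, hA.pay_le_one v i⟩) fun v => ?_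
  · rw [Thresholds.auction_alloc]
    split_ifs with hwin
    · have h1 : 1 ≤ θ.index i (v i) := (Thresholds.winLevel_pos i _).trans_le hwin
      have h1' : (1 : ℝ) ≤ θ.index i (v i) := by exact_mod_cast h1
      have h2 : (θ.index i (v i) : ℝ) ≤ s + 1 := by exact_mod_cast θ.index_le i (v i)
      rw [mul_one, abs_of_nonneg (div_nonneg (by linarith) hs0.le), div_le_one hs0]
      linarith
    · simp
  · simp only [Function.update_self, Thresholds.auction_alloc, Thresholds.auction_pay,
      Thresholds.winLevel_update]
    -- Facing critical level `j + 1`, the bidder is offered the price `τ i j`; for `j > s` he cannot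
    -- win.
    obtain ⟨j, hj⟩ : ∃ j, Thresholds.winLevel i (θ.indices v) = j + 1 :=
      Nat.exists_eq_succ_of_ne_zero (Thresholds.winLevel_pos i _).ne'
    rw [hj]
    rcases le_or_gt j s with hjs | hjs
    · have hint : ∀ k, Integrable ((Set.Ici (τ i k)).indicator (1 : unitInterval → ℝ)) (D i) :=
        fun k => (integrable_const (1 : ℝ)).indicator measurableSet_Ici
      have hval : ∀ k, ∫ b, (Set.Ici (τ i k)).indicator (1 : unitInterval → ℝ) b ∂(D i)
          = demand (D i) (τ i k) := fun k => integral_indicator_one measurableSet_Ici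
      have hind : ∀ b, (if j + 1 ≤ θ.index i b then (1 : ℝ) else 0)
          = (Set.Ici (τ i j)).indicator (1 : unitInterval → ℝ) b := fun b =>
        (indicator_Ici_ladder hlad.top hjs b).symm
      have hpay : ∀ b, (if j + 1 ≤ θ.index i b then (θ.fullThreshold i (j + 1) : ℝ) else 0)
          = τ i j * (Set.Ici (τ i j)).indicator (1 : unitInterval → ℝ) b := fun b => by
        rw [← hind, hθ, fullThreshold_ladderThresholds hlad.top hjs]
        simp
      simp only [hpay, hind]
      rw [integral_const_mul, hval]
      simp only [hθ, level_mul_indicator_eq hlad.top hjs]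
      rw [integral_add ((hint j).const_mul _)
        ((integrable_finsetSum _ fun k _ => hint k).const_mul _), integral_const_mul,
        integral_const_mul, integral_finsetSum _ fun k _ => hint k, hval]
      simp only [hval]
      have h1 := hlad.le_ladderProfit hs (s - j) j (by omega)
      unfold ladderProfit at h1
      linarith
    · have hno : ∀ b, ¬ j + 1 ≤ θ.index i b := fun b h => by
        have := θ.index_le i b
        omega
      simp [hno]

theorem Thresholds.exists_wins (θ : Thresholds n s) (v : Profile n) {i : Fin n}
    (hi : 0 < θ.index i (v i)) : ∃ k, θ.Wins v k ∧ ∀ l, θ.index l (v l) ≤ θ.index k (v k) := by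
  obtain ⟨k₀, -, hk₀⟩ := Finset.exists_max_image Finset.univ (fun l => θ.index l (v l))
    ⟨i, Finset.mem_univ i⟩
  obtain ⟨k, hk, hmin⟩ := Finset.exists_min_image
    (Finset.univ.filter fun l => θ.index l (v l) = θ.index k₀ (v k₀)) id ⟨k₀, by simp⟩
  have hk' : θ.index k (v k) = θ.index k₀ (v k₀) := (Finset.mem_filter.1 hk).2
  have hmax : ∀ l, θ.index l (v l) ≤ θ.index k (v k) := fun l => by
    rw [hk']
    exact hk₀ l (Finset.mem_univ l)
  refine ⟨k, ⟨hi.trans_le (hmax i), fun l hl => ?_⟩, hmax⟩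
  rcases (hmax l).lt_or_eq with h | h
  · exact Or.inl h
  · exact Or.inr ⟨h, lt_of_le_of_ne (hmin l (by simp [h, hk'])) hl.symm⟩

/-- Winning probabilities add up to at most `1`, so the left side is at most the highest index over
`s`. The level auction serves a bidder with that index, whose term falls short by exactly `1/s`. If
all indices are `0`, the left side is at most `0`. -/
theorem sum_ladderValue_mul_alloc_le {A : Auction n} (hA : A.IsTruthful) (hs : 1 ≤ s)
    (htop : ∀ i, τ i s = 1) (v : Profile n) :
    ∑ i, ladderValue s (τ i) (v i) * A.alloc v i
      ≤ 1 / s + ∑ i, (((ladderThresholds s τ hτ).index i (v i) : ℝ) - 1) / s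
        * (ladderThresholds s τ hτ).auction.alloc v i := by
  classical
  set θ := ladderThresholds s τ hτ with hθ
  have hs0 : (0 : ℝ) < s := by exact_mod_cast hs
  have hterm : ∀ i, 0 ≤ ((θ.index i (v i) : ℝ) - 1) / s * θ.auction.alloc v i := fun i => by
    rw [Thresholds.auction_alloc]
    split_ifs with hwin
    · have h1 : 1 ≤ θ.index i (v i) := (Thresholds.winLevel_pos i _).trans_le hwin
      have h1' : (1 : ℝ) ≤ θ.index i (v i) := by exact_mod_cast h1
      exact mul_nonneg (div_nonneg (by linarith) hs0.le) zero_le_one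
    · simp
  have hle : ∀ M : ℕ, (∀ i, θ.index i (v i) ≤ M) →
      ∑ i, ladderValue s (τ i) (v i) * A.alloc v i ≤ M / s := fun M hM => by
    have hMs : (0 : ℝ) ≤ M / s := by positivity
    calc ∑ i, ladderValue s (τ i) (v i) * A.alloc v i ≤ ∑ i, M / s * A.alloc v i := by
          refine Finset.sum_le_sum fun i _ =>
            mul_le_mul_of_nonneg_right ?_ (hA.alloc_nonneg v i)
          refine (ladderValue_le_index (hτ := hτ) (htop i) (v i)).trans ?_
          have : (θ.index i (v i) : ℝ) ≤ M := by exact_mod_cast hM i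
          gcongr
      _ = M / s * ∑ i, A.alloc v i := by rw [Finset.mul_sum]
      _ ≤ M / s := mul_le_of_le_one_right hMs (hA.alloc_sum_le_one v)
  by_cases hpos : ∃ i, 0 < θ.index i (v i)
  · obtain ⟨i, hi⟩ := hpos
    obtain ⟨k, hk, hmax⟩ := θ.exists_wins v hi
    have h1 := hle _ hmax
    have h2 := Finset.single_le_sum (fun i _ => hterm i) (Finset.mem_univ k)
    have h3 : θ.auction.alloc v k = 1 := by
      rw [Thresholds.auction_alloc, if_pos ((θ.wins_iff v k).1 hk)]
    rw [h3, mul_one, sub_div] at h2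
    linarith
  · push Not at hpos
    have h1 := hle 0 hpos
    have h2 : 0 ≤ ∑ i, ((θ.index i (v i) : ℝ) - 1) / s * θ.auction.alloc v i :=
      Finset.sum_nonneg fun i _ => hterm i
    have h3 : (0 : ℝ) ≤ 1 / s := by positivity
    simp only [Nat.cast_zero, zero_div] at h1
    linarith

end Lower

/-- Level auctions with grid width `1 / s` are optimal up to `1 / s`. -/
theorem OPT_sub_le_levelOPT {s : ℕ} (hs : 1 ≤ s) (D : Fin n → Measure unitInterval)
    [∀ i, IsProbabilityMeasure (D i)] : OPT D - 1 / (s : ℝ) ≤ levelOPT s D := by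
  choose τ hlad using fun i => exists_isPriceLadder (D i) hs
  have hs0 : (0 : ℝ) < s := by exact_mod_cast hs
  set θ := ladderThresholds s τ fun i => (hlad i).mono with hθ
  rw [sub_le_iff_le_add]
  refine ciSup_le fun A => ?_
  obtain ⟨A, hA⟩ := A
  refine le_trans ?_ (add_le_add_left (expectedRevenue_le_levelOPT D θ) _)
  have hT := θ.auction_isTruthful
  have hpayint : ∀ {B : Auction n}, B.IsTruthful → ∀ i,
      Integrable (fun v => B.pay v i) (Measure.pi D) := fun hB i =>
    integrable_of_abs_le (hB.measurable_pay i) fun v =>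
      abs_le.2 ⟨hB.neg_one_le_pay v i, hB.pay_le_one v i⟩
  have hrev : ∀ {B : Auction n}, B.IsTruthful →
      expectedRevenue D B = ∑ i, ∫ v, B.pay v i ∂(Measure.pi D) := fun hB =>
    integral_finsetSum _ fun i _ => hpayint hB i
  have hvalint : ∀ i, Integrable (fun v : Profile n => ladderValue s (τ i) (v i) * A.alloc v i)
      (Measure.pi D) := fun i =>
    integrable_of_abs_le (c := 1)
      ((measurable_ladderValue.comp (measurable_pi_apply i)).mul (hA.measurable_alloc i))
      fun v => by
        rw [abs_of_nonneg (mul_nonneg (ladderValue_nonneg _) (hA.alloc_nonneg v i))]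
        exact mul_le_one₀ (ladderValue_le_one _) (hA.alloc_nonneg v i) (hA.alloc_le_one v i)
  have hlevint : ∀ i, Integrable (fun v : Profile n =>
      ((θ.index i (v i) : ℝ) - 1) / s * θ.auction.alloc v i) (Measure.pi D) := fun i => by
    have hidx : Measurable fun v : Profile n => (θ.index i (v i) : ℝ) :=
      (measurable_of_countable (fun k : ℕ => (k : ℝ))).comp
        (Thresholds.measurable_index (fun _ _ => measurable_const) measurable_id i)
    refine integrable_of_abs_le (c := (s + 2) / s)
      (((hidx.sub_const 1).div_const _).mul (hT.measurable_alloc i)) fun v => ?_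
    have h1 : (θ.index i (v i) : ℝ) ≤ s + 1 := by exact_mod_cast θ.index_le i (v i)
    have h2 : (0 : ℝ) ≤ θ.index i (v i) := Nat.cast_nonneg _
    rw [abs_mul, abs_div, abs_of_pos hs0, abs_of_nonneg (hT.alloc_nonneg v i)]
    refine (mul_le_of_le_one_right (by positivity) (hT.alloc_le_one v i)).trans ?_
    gcongr
    rw [abs_le]
    constructor <;> linarith
  calc expectedRevenue D A = ∑ i, ∫ v, A.pay v i ∂(Measure.pi D) := hrev hA
    _ ≤ ∑ i, ∫ v, ladderValue s (τ i) (v i) * A.alloc v i ∂(Measure.pi D) :=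
        Finset.sum_le_sum fun i _ => hA.integral_pay_le D hs i (hlad i)
    _ = ∫ v, ∑ i, ladderValue s (τ i) (v i) * A.alloc v i ∂(Measure.pi D) :=
        (integral_finsetSum _ fun i _ => hvalint i).symm
    _ ≤ ∫ v, (1 / s + ∑ i, ((θ.index i (v i) : ℝ) - 1) / s * θ.auction.alloc v i)
          ∂(Measure.pi D) :=
        integral_mono (integrable_finsetSum _ fun i _ => hvalint i)
          ((integrable_const _).add (integrable_finsetSum _ fun i _ => hlevint i))
          (sum_ladderValue_mul_alloc_le hA hs fun i => (hlad i).top)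
    _ = 1 / s + ∑ i, ∫ v, ((θ.index i (v i) : ℝ) - 1) / s * θ.auction.alloc v i
          ∂(Measure.pi D) := by
        rw [integral_add (integrable_const _) (integrable_finsetSum _ fun i _ => hlevint i),
          integral_finsetSum _ fun i _ => hlevint i]
        simp
    _ ≤ 1 / s + ∑ i, ∫ v, θ.auction.pay v i ∂(Measure.pi D) :=
        add_le_add le_rfl (Finset.sum_le_sum fun i _ =>
          integral_level_mul_alloc_le D hs i (hlad i))
    _ = expectedRevenue D θ.auction + 1 / s := by rw [hrev hT, add_comm]

end LevelAuctions

/-! ### Balancing the errors; sample complexity -/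

namespace LevelAuctions

theorem gridWidth_pos {n m : ℕ} (hn : 1 ≤ n) (hm : 1 ≤ m) : 0 < gridWidth n m := by
  have hn0 : (0 : ℝ) < n := by exact_mod_cast hn
  have hm0 : (1 : ℝ) ≤ m := by exact_mod_cast hm
  have hlog : 0 < Real.log (2 * (m : ℝ)) := Real.log_pos (by linarith)
  exact Real.rpow_pos_of_pos (by positivity) _

theorem gridWidth_pow_three (n m : ℕ) (hm : 1 ≤ m) :
    gridWidth n m ^ 3 = 2 * (n : ℝ) * Real.log (2 * (m : ℝ)) / (m : ℝ) := by
  have hm0 : (1 : ℝ) ≤ m := by exact_mod_cast hm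
  have hlog : 0 < Real.log (2 * (m : ℝ)) := Real.log_pos (by linarith)
  unfold gridWidth
  rw [← Real.rpow_natCast, ← Real.rpow_mul (by positivity)]
  norm_num

/-- Rounding the reciprocal of the grid width up to an integer does not spoil the balance of the
two errors. -/
theorem one_div_add_sqrt_le {e s : ℝ} (he : 0 < e) (he1 : e ≤ 1 / 2) (hs1 : 1 / e ≤ s)
    (hs2 : s ≤ 1 / e + 1) : 1 / s + Real.sqrt (s * e ^ 3) ≤ 2 * e := by
  have hx1 : 1 ≤ s * e := by rwa [div_le_iff₀ he] at hs1
  have hx2 : s * e ≤ 2 := by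
    have : s * e ≤ (1 / e + 1) * e := by gcongr
    rw [add_mul, one_div_mul_cancel he.ne'] at this
    linarith
  set y := Real.sqrt (s * e) with hy
  have hysq : y ^ 2 = s * e := Real.sq_sqrt (by linarith)
  have hy1 : 1 ≤ y := Real.one_le_sqrt.2 hx1
  have hy2 : y ≤ 3 / 2 := by nlinarith
  have hsqrt : Real.sqrt (s * e ^ 3) = e * y := by
    rw [show s * e ^ 3 = e ^ 2 * (s * e) by ring, Real.sqrt_mul (by positivity),
      Real.sqrt_sq he.le]
  have hinv : 1 / s = e * (1 / y ^ 2) := by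
    rw [hysq]
    have : s ≠ 0 := by
      rintro rfl
      norm_num at hx1
    field_simp
  -- With `y² = s e`, the claim divided by `e` is `1/y² + y ≤ 2`. The factor `1 + y - y²` is
  -- nonnegative for `1 ≤ y ≤ 3/2`.
  have hmain : 1 / y ^ 2 + y ≤ 2 := by
    have hpos : 0 < y ^ 2 := by positivity
    rw [← sub_nonneg, show 2 - (1 / y ^ 2 + y) = (y - 1) * (1 + y - y ^ 2) / y ^ 2 by
      field_simp; ring]
    refine div_nonneg (mul_nonneg (by linarith) (by nlinarith)) hpos.le
  rw [hsqrt, hinv, ← mul_add, mul_comm 2 e]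
  gcongr

/-- The error of the learner against the optimal auction. -/
theorem IsERM.OPT_sub_le {n m : ℕ} (hn : 1 ≤ n) (hm : 1 ≤ m)
    {h : Sample n → Thresholds n (levels n m)} (hh : IsERM h) (D : Fin n → Measure unitInterval)
    [∀ i, IsProbabilityMeasure (D i)] :
    OPT D - 2 * gridWidth n m ≤ expectedLearnedRevenue D h m := by
  have he := gridWidth_pos hn hm
  rcases le_or_gt (gridWidth n m) (1 / 2) with hle | hgt
  · have hs1 : 1 / gridWidth n m ≤ levels n m := Nat.le_ceil _
    have hs2 : (levels n m : ℝ) ≤ 1 / gridWidth n m + 1 :=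
      (Nat.ceil_lt_add_one (by positivity)).le
    have h2 : (2 : ℝ) ≤ 1 / gridWidth n m := by
      rw [le_div_iff₀ he]
      linarith
    have hs : 2 ≤ levels n m := by exact_mod_cast h2.trans hs1
    have h3 := hh.levelOPT_sub_le hn hs hm D
    have h4 := OPT_sub_le_levelOPT (by omega : 1 ≤ levels n m) D
    have h5 := one_div_add_sqrt_le he hle hs1 hs2
    rw [gridWidth_pow_three n m hm, show (levels n m : ℝ) *
      (2 * (n : ℝ) * Real.log (2 * (m : ℝ)) / (m : ℝ))
      = 2 * (n : ℝ) * (levels n m : ℝ) * Real.log (2 * (m : ℝ)) / (m : ℝ) by ring] at h5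
    linarith
  -- For grid width above `1/2` the permitted loss exceeds `1`, hence `OPT`.
  · have h1 := OPT_le_one D
    have h2 : 0 ≤ expectedLearnedRevenue D h m :=
      integral_nonneg fun z => (h (sampleOf z)).auction_isTruthful.expectedRevenue_nonneg D
    linarith

/-- This is `(2 e)³ ≤ ε³` for `e` the grid width, cleared of denominators. -/
theorem sixteen_mul_log_le {n : ℕ} (hn : 1 ≤ n) {ε : ℝ} (hε : 0 < ε) (hε1 : ε ≤ 1 / 2) {m : ℝ}
    (hm : 288 * (n * Real.log (n / ε) / ε ^ 3) ≤ m) :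
    16 * n * Real.log (2 * m) ≤ m * ε ^ 3 := by
  have hn1 : (1 : ℝ) ≤ n := by exact_mod_cast hn
  have hn0 : (0 : ℝ) < n := by linarith
  have hratio : 2 ≤ (n : ℝ) / ε := by
    rw [le_div_iff₀ hε]
    linarith
  have hlog2 : Real.log 2 ≤ Real.log (n / ε) := Real.log_le_log (by norm_num) hratio
  have hlog2pos : 0 < Real.log 2 := Real.log_pos (by norm_num)
  have hL : 0 < Real.log (n / ε) := by linarith
  have hε3 : 0 < ε ^ 3 := by positivity
  have hm0 : 0 < m := lt_of_lt_of_le (by positivity) hm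
  -- The tangent to `log` at this point has a linear part using up half of `m ε³`. Its constant is
  -- at most `(6 + 3) log (n/ε)`, as `2 ≤ n/ε`; the other half must cover `16 · 9 = 144`, whence
  -- `288`.
  have ha : 0 < 64 * (n : ℝ) / ε ^ 3 := by positivity
  have htangent : Real.log (2 * m) ≤ m * ε ^ 3 / (32 * n) + Real.log (64 * n / ε ^ 3) := by
    have h1 := Real.log_le_sub_one_of_pos (show 0 < 2 * m / (64 * n / ε ^ 3) by positivity)
    rw [Real.log_div (by positivity) ha.ne'] at h1
    have h2 : 2 * m / (64 * n / ε ^ 3) = m * ε ^ 3 / (32 * n) := by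
      field_simp
      ring
    linarith
  have hlog : Real.log (64 * n / ε ^ 3) ≤ 9 * Real.log (n / ε) := by
    have h1 : 64 * (n : ℝ) / ε ^ 3 ≤ 2 ^ 6 * (n / ε) ^ 3 := by
      rw [div_pow, ← mul_div_assoc]
      gcongr
      · norm_num
      · exact le_self_pow₀ hn1 three_ne_zero
    have h2 := Real.log_le_log ha h1
    rw [Real.log_mul (by norm_num) (by positivity), Real.log_pow, Real.log_pow] at h2
    push_cast at h2
    linarith
  have h3 : 16 * n * (m * ε ^ 3 / (32 * n)) = m * ε ^ 3 / 2 := by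
    field_simp
    ring
  have h4 : 288 * (n * Real.log (n / ε)) ≤ m * ε ^ 3 := by
    rw [← mul_div_assoc, div_le_iff₀ hε3] at hm
    exact hm
  calc 16 * n * Real.log (2 * m)
      ≤ 16 * n * (m * ε ^ 3 / (32 * n) + 9 * Real.log (n / ε)) := by
        gcongr
        linarith
    _ = m * ε ^ 3 / 2 + 144 * (n * Real.log (n / ε)) := by
        rw [mul_add, h3]
        ring
    _ ≤ m * ε ^ 3 := by linarith

theorem two_mul_gridWidth_le {n m : ℕ} (hn : 1 ≤ n) (hm1 : 1 ≤ m) {ε : ℝ} (hε : 0 < ε)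
    (hε1 : ε ≤ 1 / 2) (hm : 288 * (n * Real.log (n / ε) / ε ^ 3) ≤ m) :
    2 * gridWidth n m ≤ ε := by
  have hm0 : (0 : ℝ) < m := by exact_mod_cast hm1
  refine le_of_pow_le_pow_left₀ three_ne_zero hε.le ?_
  rw [mul_pow, gridWidth_pow_three n m hm1, ← mul_div_assoc, div_le_iff₀ hm0]
  have := sixteen_mul_log_le hn hε hε1 hm
  linarith

/-- This absorbs the `+1` from rounding up, turning `288` into `289`. -/
theorem one_le_sampleBound {n : ℕ} (hn : 1 ≤ n) {ε : ℝ} (hε : 0 < ε) (hε1 : ε ≤ 1 / 2) :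
    1 ≤ n * Real.log (n / ε) / ε ^ 3 := by
  have hn1 : (1 : ℝ) ≤ n := by exact_mod_cast hn
  have hratio : 2 ≤ (n : ℝ) / ε := by
    rw [le_div_iff₀ hε]
    linarith
  have hlog2 : Real.log 2 ≤ Real.log (n / ε) := Real.log_le_log (by norm_num) hratio
  have hlog := Real.log_two_gt_d9
  have hε3 : ε ^ 3 ≤ (1 / 2) ^ 3 := by gcongr
  rw [le_div_iff₀ (by positivity)]
  nlinarith

theorem log_div_le_two_mul {n : ℕ} (hn : 1 ≤ n) {ε : ℝ} (hε : 0 < ε) (hεn : ε ≤ 1 / (n : ℝ)) :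
    Real.log (n / ε) ≤ 2 * Real.log (1 / ε) := by
  have hn0 : (0 : ℝ) < n := by exact_mod_cast hn
  have h : (n : ℝ) ≤ 1 / ε := by
    rw [le_div_iff₀ hε, mul_comm]
    rwa [le_div_iff₀ hn0] at hεn
  calc Real.log (n / ε) ≤ Real.log ((1 / ε) ^ 2) := by
        refine Real.log_le_log (by positivity) ?_
        rw [sq, div_eq_mul_one_div (n : ℝ)]
        gcongr
    _ = 2 * Real.log (1 / ε) := by
        rw [Real.log_pow]
        norm_num

/-- The sample complexity of the learner. -/
theorem exists_isLeast_accurateFrom {n : ℕ} (hn : 1 ≤ n)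
    {h : ∀ s : ℕ, Sample n → Thresholds n s} (hh : ∀ s, IsERM (h s)) {ε : ℝ} (hε : 0 < ε)
    (hε1 : ε ≤ 1 / 2) :
    ∃ k : ℕ, IsLeast (accurateFrom h ε) k ∧
      (k : ℝ) ≤ 289 * ((n : ℝ) * Real.log ((n : ℝ) / ε) / ε ^ 3) := by
  classical
  set B := (n : ℝ) * Real.log ((n : ℝ) / ε) / ε ^ 3 with hB
  have hB1 : 1 ≤ B := one_le_sampleBound hn hε hε1
  have hmem : ⌈288 * B⌉₊ ∈ accurateFrom h ε := by
    intro m hm D hD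
    have hmB : 288 * B ≤ m := (Nat.le_ceil _).trans (by exact_mod_cast hm)
    have hm1 : 1 ≤ m := by
      have : (1 : ℝ) ≤ m := by linarith
      exact_mod_cast this
    have h1 := (hh (levels n m)).OPT_sub_le hn hm1 D
    have h2 := two_mul_gridWidth_le hn hm1 hε hε1 hmB
    linarith
  refine ⟨Nat.find ⟨_, hmem⟩, ⟨Nat.find_spec _, fun k hk => Nat.find_min' _ hk⟩, ?_⟩
  have h1 : (Nat.find ⟨_, hmem⟩ : ℕ) ≤ ⌈288 * B⌉₊ := Nat.find_min' _ hmem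
  have h2 : ((Nat.find ⟨_, hmem⟩ : ℕ) : ℝ) ≤ (⌈288 * B⌉₊ : ℝ) := by exact_mod_cast h1
  have h3 : (⌈288 * B⌉₊ : ℝ) < 288 * B + 1 := Nat.ceil_lt_add_one (by linarith)
  linarith

end LevelAuctions

end

theorem mainTheorem5 :
    -- level auctions are dominant strategy truthful
    (∀ (n s : ℕ) (θ : LevelAuctions.Thresholds n s), θ.auction.IsTruthful) ∧
    -- empirical revenue can be maximized with thresholds at sample values
    (∀ n s : ℕ, ∃ h : LevelAuctions.Sample n → LevelAuctions.Thresholds n s,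
      LevelAuctions.IsERM h) ∧
    -- split-sample growth rate, and the resulting bound against the best level auction
    (∀ n s : ℕ, 1 ≤ n → 2 ≤ s →
      ∀ h : LevelAuctions.Sample n → LevelAuctions.Thresholds n s, LevelAuctions.IsERM h →
      ∀ m : ℕ, 1 ≤ m →
        LevelAuctions.growthRate h m ≤ ((m ^ (n * s) : ℕ) : ℕ∞) ∧
        ∀ D : Fin n → MeasureTheory.Measure unitInterval,
          (∀ i, MeasureTheory.IsProbabilityMeasure (D i)) →
          LevelAuctions.levelOPT s D
              - Real.sqrt (2 * (n : ℝ) * (s : ℝ) * Real.log (2 * (m : ℝ)) / (m : ℝ))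
            ≤ LevelAuctions.expectedLearnedRevenue D h m) ∧
    -- level auctions with grid width `1 / s` are optimal up to `1 / s`
    (∀ n s : ℕ, 1 ≤ n → 1 ≤ s → ∀ D : Fin n → MeasureTheory.Measure unitInterval,
      (∀ i, MeasureTheory.IsProbabilityMeasure (D i)) →
      LevelAuctions.OPT D - 1 / (s : ℝ) ≤ LevelAuctions.levelOPT s D) ∧
    -- the error bound against the optimal auction
    (∀ n : ℕ, 1 ≤ n → ∀ m : ℕ, 1 ≤ m →
      ∀ h : LevelAuctions.Sample n → LevelAuctions.Thresholds n (LevelAuctions.levels n m),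
      LevelAuctions.IsERM h →
      ∀ D : Fin n → MeasureTheory.Measure unitInterval,
        (∀ i, MeasureTheory.IsProbabilityMeasure (D i)) →
        LevelAuctions.OPT D
            - 2 * (2 * (n : ℝ) * Real.log (2 * (m : ℝ)) / (m : ℝ)) ^ (1 / 3 : ℝ)
          ≤ LevelAuctions.expectedLearnedRevenue D h m) ∧
    -- the sample complexity, with a universal constant
    (∃ C : ℝ, 0 < C ∧ ∀ n : ℕ, 1 ≤ n →
      ∀ h : ∀ s : ℕ, LevelAuctions.Sample n → LevelAuctions.Thresholds n s,
      (∀ s, LevelAuctions.IsERM (h s)) →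
      ∀ ε : ℝ, 0 < ε → ε ≤ 1 / 2 →
        ∃ k : ℕ, IsLeast (LevelAuctions.accurateFrom h ε) k ∧
          (k : ℝ) ≤ C * ((n : ℝ) * Real.log ((n : ℝ) / ε) / ε ^ 3) ∧
          (ε ≤ 1 / (n : ℝ) → (k : ℝ) ≤ C * ((n : ℝ) * Real.log (1 / ε) / ε ^ 3))) := by
  refine ⟨fun n s θ => θ.auction_isTruthful, LevelAuctions.exists_isERM, ?_, ?_, ?_, ?_⟩
  · intro n s hn hs h hh m hm
    exact ⟨hh.growthRate_le hn hs hm, fun D hD => hh.levelOPT_sub_le hn hs hm D⟩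
  · intro n s _ hs D hD
    exact LevelAuctions.OPT_sub_le_levelOPT hs D
  · intro n hn m hm h hh D hD
    exact hh.OPT_sub_le hn hm D
  -- `578 = 2 · 289`: replacing `log (n/ε)` by `log (1/ε)` costs a factor of two when `n ≤ 1/ε`.
  · refine ⟨578, by norm_num, fun n hn h hh ε hε hε1 => ?_⟩
    obtain ⟨k, hk, hkle⟩ := LevelAuctions.exists_isLeast_accurateFrom hn hh hε hε1
    have hB := LevelAuctions.one_le_sampleBound hn hε hε1
    refine ⟨k, hk, by linarith, fun hεn => hkle.trans ?_⟩
    have hlog := LevelAuctions.log_div_le_two_mul hn hε hεn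
    calc 289 * ((n : ℝ) * Real.log ((n : ℝ) / ε) / ε ^ 3)
        ≤ 289 * ((n : ℝ) * (2 * Real.log (1 / ε)) / ε ^ 3) := by gcongr
      _ = 578 * ((n : ℝ) * Real.log (1 / ε) / ε ^ 3) := by ring
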